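/- Let $q$ be a prime power and let $\mathbb F_{q^2}(x,y)$, with $y^q+y=x^{q+1}$, be the function field of the Hermitian curve $\mathcal H_q\colon Y^q+Y=X^{q+1}$ over $\mathbb F_{q^2}$. Let $O=(0,0)$ and let $Y_\infty=(0:1:0)$ be the unique point at infinity of $\mathcal H_q$. The chord $OY_\infty$, that is, the line $X=0$, contains exactly $q-1$ points $Q_1,\dots,Q_{q-1}$ of $\mathcal H_q$ other than $O$ and $Y_\infty$, all of them $\mathbb F_{q^2}$-rational. For an integer $m$ with $2\le m\le q-1$ let $\mathtt G=m(Q_1+\dots+Q_{q-1})$, and let $$\mathcal L(\mathtt G)=\{f\in\mathbb F_{q^2}(x,y) : f=0 \text{ or } \operatorname{div}(f)+\mathtt G\ge 0\}$$ be its Riemann–Roch space over $\mathbb F_{q^2}$. Then $$\mathcal L(\mathtt G)=\Bigl\{\frac{y\,g(x,y)+\varepsilon x^m}{x^m} : g\in\mathbb F_{q^2}[X,Y],\ \deg g\le m-2,\ \varepsilon\in\mathbb F_{q^2}\Bigr\},$$ where $\deg g$ is the total degree (and $g=0$ is allowed). Moreover $\deg(\mathtt G)=m(q-1)$ and $\dim_{\mathbb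 F_{q^2}}\mathcal L(\mathtt G)=\tfrac12 m(m-1)+1$. -/

import Mathlib

noncomputable section

open Polynomial

/-! ### Places, divisors and Riemann–Roch spaces of a field extension `F / K` -/

/-- A place of `F / K`, given by its valuation ring: a discrete valuation ring of `F`
(in particular a proper subring with fraction field `F`) that contains `K`. In a function
field of one variable every valuation ring `O` with `K ⊆ O ⊊ F` is of this kind. -/
structure Place (K F : Type*) [Field K] [Field F] [Algebra K F] where
  /-- The valuation ring of the place. -/
  ring : ValuationSubring F
  algebraMap_mem : ∀ a : K, algebraMap K F a ∈ ring
  isDVR : IsDiscreteValuationRing ring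

namespace Place

variable {K F : Type*} [Field K] [Field F] [Algebra K F] (P : Place K F)

instance : IsDiscreteValuationRing P.ring := P.isDVR

instance : Algebra K P.ring :=
  ((algebraMap K F).codRestrict P.ring P.algebraMap_mem).toAlgebra

/-- The valuation of a place in Mathlib's multiplicative form. -/
def valuation : Valuation F (WithZero (Multiplicative ℤ)) :=
  (IsDiscreteValuationRing.maximalIdeal P.ring).valuation F

/-- The order `v_P(f)` of a function at a place (normalised, additive). Only meaningful
for `f ≠ 0`; it takes the value `0` at `f = 0`. -/
def ord (f : F) : ℤ := -WithZero.log (P.valuation f)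

/-- The degree of a place: the degree of its residue field over `K`. -/
def degree : ℕ := Module.finrank K (IsLocalRing.ResidueField P.ring)

end Place

/-- Divisors of `F / K`: formal integral combinations of places. -/
abbrev Divisor (K F : Type*) [Field K] [Field F] [Algebra K F] := Place K F →₀ ℤ

/-- The degree of a divisor. -/
def Divisor.degree {K F : Type*} [Field K] [Field F] [Algebra K F] (G : Divisor K F) : ℤ :=
  G.sum fun P n => n * (P.degree : ℤ)

theorem Place.zero_le_ord_add_iff {K F : Type*} [Field K] [Field F] [Algebra K F]
    (P : Place K F) {f : F} (hf : f ≠ 0) (n : ℤ) :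
    0 ≤ P.ord f + n ↔ P.valuation f ≤ WithZero.exp n := by
  rw [← WithZero.log_le_iff_le_exp ((Valuation.ne_zero_iff _).2 hf), Place.ord]
  constructor <;> intro h <;> linarith

/-- The Riemann–Roch space `L(G)`: the functions `f` with `f = 0` or `div f + G ≥ 0`. -/
def riemannRochSpace {K F : Type*} [Field K] [Field F] [Algebra K F] (G : Divisor K F) :
    Submodule K F where
  carrier := {f | f = 0 ∨ ∀ P : Place K F, 0 ≤ P.ord f + G P}
  zero_mem' := Or.inl rfl
  add_mem' := by
    intro f g hf hg
    by_cases hf0 : f = 0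
    · simpa [hf0] using hg
    by_cases hg0 : g = 0
    · simpa [hg0] using hf
    by_cases hfg : f + g = 0
    · exact Or.inl hfg
    refine Or.inr fun P => ?_
    rw [P.zero_le_ord_add_iff hfg]
    refine P.valuation.map_add_le ?_ ?_
    · exact (P.zero_le_ord_add_iff hf0 _).1 ((hf.resolve_left hf0) P)
    · exact (P.zero_le_ord_add_iff hg0 _).1 ((hg.resolve_left hg0) P)
  smul_mem' := by
    intro c f hf
    by_cases hcf : c • f = 0
    · exact Or.inl hcf
    have hf0 : f ≠ 0 := fun h => hcf (by simp [h])
    refine Or.inr fun P => ?_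
    rw [P.zero_le_ord_add_iff hcf, Algebra.smul_def, map_mul]
    have h1 := (P.zero_le_ord_add_iff hf0 _).1 ((hf.resolve_left hf0) P)
    have h2 : P.valuation (algebraMap K F c) ≤ 1 :=
      (IsDiscreteValuationRing.maximalIdeal P.ring).valuation_le_one
        (⟨algebraMap K F c, P.algebraMap_mem c⟩ : P.ring)
    exact (mul_le_mul' h2 h1).trans_eq (one_mul _)

/-! ### The Hermitian curve `Y ^ q + Y = X ^ (q + 1)` over the field `K` with `q ^ 2` elements -/

namespace Hermitian

/-- The equation of the Hermitian curve, as a polynomial in the variable `X` with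
coefficients in `K[Y]`. The outer variable is `X`, the inner variable is `Y`. -/
def equation (K : Type*) [Field K] (q : ℕ) : K[X][X] :=
  X ^ (q + 1) - C (X ^ q + X)

/-- The affine coordinate ring `K[X, Y] / (Y ^ q + Y - X ^ (q + 1))`. -/
abbrev CoordinateRing (K : Type*) [Field K] (q : ℕ) := AdjoinRoot (equation K q)

section

variable (K : Type*) [Field K] (q : ℕ)

/-- The class of `X` in the coordinate ring. -/
def xR : CoordinateRing K q := AdjoinRoot.root (equation K q)

/-- The class of `Y` in the coordinate ring. -/
def yR : CoordinateRing K q := AdjoinRoot.of (equation K q) X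

theorem equation_xR_yR : yR K q ^ q + yR K q = xR K q ^ (q + 1) := by
  have h : AdjoinRoot.mk (equation K q) (X ^ (q + 1) - C (X ^ q + X)) = 0 := AdjoinRoot.mk_self
  rw [map_sub, map_pow, AdjoinRoot.mk_X, AdjoinRoot.mk_C, map_add, map_pow] at h
  exact (sub_eq_zero.1 h).symm

theorem monic_equation : (equation K q).Monic :=
  monic_X_pow_sub_C _ (Nat.succ_ne_zero q)

theorem natDegree_equation : (equation K q).natDegree = q + 1 :=
  natDegree_X_pow_sub_C

theorem two_le (K : Type*) [Field K] [Finite K] (q : ℕ) [hK : Fact (Nat.card K = q ^ 2)] :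
    2 ≤ q := by
  have h1 := Finite.one_lt_card (α := K)
  rw [hK.out] at h1
  by_contra h
  have : q = 0 ∨ q = 1 := by omega
  rcases this with rfl | rfl <;> simp at h1

variable [Finite K] [hK : Fact (Nat.card K = q ^ 2)]

theorem cast_q_eq_zero : (q : K) = 0 := by
  have := Fintype.ofFinite K
  have h := Nat.cast_card_eq_zero K
  rw [← Nat.card_eq_fintype_card, hK.out, Nat.cast_pow] at h
  exact pow_eq_zero_iff (two_ne_zero) |>.1 h

theorem irreducible_equation : Irreducible (equation K q) := by
  have hq := two_le K q
  have hXP : (Ideal.span {(X : K[X])}).IsPrime :=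
    (Ideal.span_singleton_prime X_ne_zero).2 prime_X
  have hdeg := natDegree_equation K q
  have hcoeff0 : (equation K q).coeff 0 = -(X ^ q + X) := by
    rw [equation, coeff_sub, coeff_C_zero, coeff_X_pow, if_neg (by omega), zero_sub]
  refine IsEisensteinAt.irreducible (𝓟 := Ideal.span {(X : K[X])}) ⟨?_, ?_, ?_⟩ hXP
    (monic_equation K q).isPrimitive (by rw [hdeg]; omega)
  · rw [(monic_equation K q).leadingCoeff]
    exact (Ideal.ne_top_iff_one _).1 hXP.ne_top
  · intro n hn
    rw [hdeg] at hn
    rcases Nat.eq_zero_or_pos n with rfl | hn0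
    · rw [hcoeff0, neg_mem_iff]
      exact add_mem (Ideal.pow_mem_of_mem _ (Ideal.mem_span_singleton_self X) q (by omega))
        (Ideal.mem_span_singleton_self X)
    · have : (equation K q).coeff n = 0 := by
        rw [equation, coeff_sub, coeff_X_pow, coeff_C, if_neg hn.ne, if_neg (by omega), sub_zero]
      rw [this]
      exact zero_mem _
  · rw [hcoeff0, neg_mem_iff, Ideal.span_singleton_pow, Ideal.mem_span_singleton, X_pow_dvd_iff]
    intro h
    have h1 := h 1 (by norm_num)
    have hq1 : (1 : ℕ) ≠ q := by omega
    simp [coeff_X_pow, hq1] at h1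

instance : IsDomain (CoordinateRing K q) :=
  AdjoinRoot.isDomain_of_prime (irreducible_equation K q).prime

/-- The function field `K(x, y)` of the Hermitian curve. -/
abbrev FunctionField := FractionRing (CoordinateRing K q)

/-- The coordinate function `x` in the function field. -/
def x : FunctionField K q := algebraMap (CoordinateRing K q) _ (xR K q)

/-- The coordinate function `y` in the function field. -/
def y : FunctionField K q := algebraMap (CoordinateRing K q) _ (yR K q)

end

/-- The points of the Hermitian curve in the affine plane over `K`. The only further point of
the projective closure is `Y_∞ = (0 : 1 : 0)`. -/
@[ext]
structure AffinePoint (K : Type*) [Field K] (q : ℕ) where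
  /-- The `X`-coordinate. -/
  a : K
  /-- The `Y`-coordinate. -/
  b : K
  on_curve : b ^ q + b = a ^ (q + 1)

namespace AffinePoint

variable {K : Type*} [Field K] {q : ℕ}

instance [Finite K] : Finite (AffinePoint K q) :=
  Finite.of_injective (fun P : AffinePoint K q => (P.a, P.b)) fun P Q h => by
    rw [Prod.mk.injEq] at h
    exact AffinePoint.ext h.1 h.2

variable (P : AffinePoint K q)

/-- Evaluation of regular functions at a point. -/
def eval : CoordinateRing K q →+* K :=
  AdjoinRoot.lift (evalRingHom P.b) P.a (by
    rw [equation, eval₂_sub, eval₂_X_pow, eval₂_C, coe_evalRingHom, eval_add, eval_pow, eval_X,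
      P.on_curve, sub_self])

@[simp] theorem eval_xR : P.eval (xR K q) = P.a := by simp [eval, xR]

@[simp] theorem eval_yR : P.eval (yR K q) = P.b := by simp [eval, yR]

@[simp] theorem eval_algebraMap (c : K) :
    P.eval (algebraMap K (CoordinateRing K q) c) = c := by
  rw [AdjoinRoot.algebraMap_eq']
  simp [eval]

/-- The maximal ideal of the regular functions that vanish at a point. -/
def ideal : Ideal (CoordinateRing K q) := RingHom.ker P.eval

theorem mem_ideal {r : CoordinateRing K q} : r ∈ P.ideal ↔ P.eval r = 0 := RingHom.mem_ker

instance : P.ideal.IsPrime := RingHom.ker_isPrime _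

theorem ideal_le : P.ideal ≤
    Ideal.span {xR K q - algebraMap K _ P.a, yR K q - algebraMap K _ P.b} := by
  intro r hr
  rw [mem_ideal] at hr
  obtain ⟨p, rfl⟩ := AdjoinRoot.mk_surjective r
  obtain ⟨s, hs⟩ := X_sub_C_dvd_sub_C_eval (a := C P.a) (p := p)
  obtain ⟨t, ht⟩ := X_sub_C_dvd_sub_C_eval (a := P.b) (p := p.eval (C P.a))
  have hz : (p.eval (C P.a)).eval P.b = 0 := by
    have := hr
    rw [eval, AdjoinRoot.lift_mk] at this
    rw [← this, ← coe_evalRingHom, ← eval₂_hom, coe_evalRingHom, eval_C]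
  rw [hz, C_0, sub_zero] at ht
  rw [Ideal.mem_span_pair]
  refine ⟨AdjoinRoot.mk _ s, AdjoinRoot.of _ t, ?_⟩
  have hp : p = (X - C (C P.a)) * s + C ((X - C P.b) * t) := by rw [← ht, ← hs]; ring
  conv_rhs => rw [hp]
  simp only [xR, yR, AdjoinRoot.algebraMap_eq', map_add, map_mul, map_sub, AdjoinRoot.mk_X,
    AdjoinRoot.mk_C, RingHom.comp_apply, Polynomial.algebraMap_eq]
  ring

variable [Finite K] [hK : Fact (Nat.card K = q ^ 2)]

theorem xR_sub_ne_zero : xR K q - algebraMap K _ P.a ≠ 0 := by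
  have h : xR K q - algebraMap K _ P.a = AdjoinRoot.mk (equation K q) (X - C (C P.a)) := by
    simp [xR, AdjoinRoot.algebraMap_eq']
  rw [h]
  refine AdjoinRoot.mk_ne_zero_of_natDegree_lt (monic_equation K q) (X_sub_C_ne_zero _) ?_
  rw [natDegree_X_sub_C, natDegree_equation]
  have := two_le K q
  omega

/-- Smoothness of the curve at an affine point: up to a function not vanishing there,
`y - b` is a multiple of `x - a`. -/
theorem exists_smooth : ∃ u h : CoordinateRing K q, P.eval u ≠ 0 ∧
    u * (yR K q - algebraMap K _ P.b) = h * (xR K q - algebraMap K _ P.a) := by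
  refine ⟨∑ i ∈ Finset.range q, yR K q ^ i * algebraMap K _ P.b ^ (q - 1 - i) + 1,
    ∑ i ∈ Finset.range (q + 1), xR K q ^ i * algebraMap K _ P.a ^ (q + 1 - 1 - i), ?_, ?_⟩
  · have h : ∀ i ∈ Finset.range q, P.b ^ i * P.b ^ (q - 1 - i) = P.b ^ (q - 1) := by
      intro i hi
      rw [Finset.mem_range] at hi
      rw [← pow_add]
      congr 1
      omega
    simp only [map_add, map_sum, map_mul, map_pow, eval_yR, eval_algebraMap, map_one]
    rw [Finset.sum_congr rfl h]
    simp [cast_q_eq_zero K q]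
  · rw [add_mul, geom_sum₂_mul, geom_sum₂_mul, ← equation_xR_yR, ← map_pow, ← map_pow,
      ← P.on_curve, map_add]
    ring

theorem isDVR_localization : IsDiscreteValuationRing (Localization.AtPrime P.ideal) := by
  set S := Localization.AtPrime P.ideal
  have : IsNoetherianRing S := IsLocalization.isNoetherianRing P.ideal.primeCompl S inferInstance
  have hinj : Function.Injective (algebraMap (CoordinateRing K q) S) :=
    IsLocalization.injective S P.ideal.primeCompl_le_nonZeroDivisors
  set t : S := algebraMap _ S (xR K q - algebraMap K _ P.a)
  have ht0 : t ≠ 0 := fun h => P.xR_sub_ne_zero (hinj (by rw [map_zero]; exact h))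
  have htmem : t ∈ IsLocalRing.maximalIdeal S :=
    (IsLocalization.AtPrime.to_map_mem_maximal_iff S P.ideal _).2 (by simp [mem_ideal])
  have hmax : IsLocalRing.maximalIdeal S = Ideal.span {t} := by
    refine le_antisymm ?_ ((Ideal.span_singleton_le_iff_mem _).2 htmem)
    rw [← IsLocalization.AtPrime.map_eq_maximalIdeal P.ideal S]
    refine (Ideal.map_mono P.ideal_le).trans ?_
    rw [Ideal.map_span, Ideal.span_le]
    rintro _ ⟨r, hr, rfl⟩
    rcases hr with rfl | hr
    · exact Ideal.mem_span_singleton_self _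
    · rw [Set.mem_singleton_iff] at hr
      obtain ⟨u, h, hu, huh⟩ := P.exists_smooth
      have hunit : IsUnit (algebraMap _ S u) :=
        IsLocalization.map_units S (⟨u, fun hm => hu (P.mem_ideal.1 hm)⟩ : P.ideal.primeCompl)
      rw [SetLike.mem_coe, hr, ← Ideal.unit_mul_mem_iff_mem _ hunit, ← map_mul, huh, map_mul]
      exact Ideal.mul_mem_left _ _ (Ideal.mem_span_singleton_self _)
  have hnf : ¬ IsField S := by
    rw [IsLocalRing.isField_iff_maximalIdeal_eq]
    intro h
    rw [h] at htmem
    exact ht0 htmem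
  have hprin : (IsLocalRing.maximalIdeal S).IsPrincipal := ⟨⟨t, hmax⟩⟩
  exact ((IsDiscreteValuationRing.TFAE S hnf).out 0 4).2 hprin

/-- The local ring of the curve at an affine point: the functions `r / s` with `r`, `s`
regular and `s` not vanishing at the point. -/
def localRing : ValuationSubring (FunctionField K q) where
  carrier := {f | ∃ r s : CoordinateRing K q, P.eval s ≠ 0 ∧
    f = algebraMap _ (FunctionField K q) r / algebraMap _ (FunctionField K q) s}
  mul_mem' := by
    rintro _ _ ⟨r, s, hs, rfl⟩ ⟨r', s', hs', rfl⟩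
    exact ⟨r * r', s * s', by simp [hs, hs'], by simp [div_mul_div_comm]⟩
  one_mem' := ⟨1, 1, by simp, by simp⟩
  add_mem' := by
    rintro _ _ ⟨r, s, hs, rfl⟩ ⟨r', s', hs', rfl⟩
    have h : ∀ {s}, P.eval s ≠ 0 → algebraMap _ (FunctionField K q) s ≠ 0 := by
      intro s hs h0
      rw [FaithfulSMul.algebraMap_eq_zero_iff] at h0
      exact hs (by simp [h0])
    exact ⟨r * s' + s * r', s * s', by simp [hs, hs'], by simp [div_add_div _ _ (h hs) (h hs')]⟩
  zero_mem' := ⟨0, 1, by simp, by simp⟩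
  neg_mem' := by
    rintro _ ⟨r, s, hs, rfl⟩
    exact ⟨-r, s, hs, by simp [neg_div]⟩
  mem_or_inv_mem' := by
    have key : ∀ r s : CoordinateRing K q, s ≠ 0 →
        algebraMap _ (Localization.AtPrime P.ideal) s ∣ algebraMap _ _ r →
        ∃ c d : CoordinateRing K q, P.eval d ≠ 0 ∧
          algebraMap _ (FunctionField K q) r / algebraMap _ (FunctionField K q) s =
            algebraMap _ (FunctionField K q) c / algebraMap _ (FunctionField K q) d := by
      rintro r s hs ⟨z, hz⟩
      obtain ⟨⟨c, d⟩, hcd⟩ := IsLocalization.surj P.ideal.primeCompl z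
      have hd : P.eval d.1 ≠ 0 := fun h => d.2 (P.mem_ideal.2 h)
      refine ⟨c, d.1, hd, ?_⟩
      have hd0 : d.1 ≠ 0 := fun h => hd (by simp [h])
      have heq : r * d.1 = c * s := by
        apply IsLocalization.injective (Localization.AtPrime P.ideal)
          P.ideal.primeCompl_le_nonZeroDivisors
        rw [map_mul, map_mul, hz, mul_assoc, hcd, mul_comm]
      rw [div_eq_div_iff (by simpa using hs) (by simpa using hd0), ← map_mul, ← map_mul, heq]
    intro f
    obtain ⟨r, s, hs, rfl⟩ := IsFractionRing.div_surjective (A := CoordinateRing K q) f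
    have hs0 : s ≠ 0 := nonZeroDivisors.ne_zero hs
    have := P.isDVR_localization
    rcases ValuationRing.dvd_total (algebraMap _ (Localization.AtPrime P.ideal) s)
      (algebraMap _ _ r) with h | h
    · exact Or.inl (key r s hs0 h)
    · by_cases hr : r = 0
      · exact Or.inl ⟨0, 1, by simp, by simp [hr]⟩
      · rw [inv_div]
        exact Or.inr (key s r hr h)

theorem isDVR_localRing : IsDiscreteValuationRing P.localRing := by
  have hu : ∀ s : P.ideal.primeCompl,
      IsUnit (algebraMap (CoordinateRing K q) (FunctionField K q) s) := by
    intro s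
    refine isUnit_iff_ne_zero.2 fun h => s.2 ?_
    rw [FaithfulSMul.algebraMap_eq_zero_iff] at h
    rw [h]
    exact zero_mem _
  let φ : Localization.AtPrime P.ideal →+* FunctionField K q := IsLocalization.lift hu
  have hmk : ∀ r (s : P.ideal.primeCompl), φ (IsLocalization.mk' _ r s) =
      algebraMap _ (FunctionField K q) r / algebraMap _ (FunctionField K q) s.1 := by
    intro r s
    rw [IsLocalization.lift_mk'_spec, mul_div_cancel₀ _ (hu s).ne_zero]
  have hmem : ∀ z, φ z ∈ P.localRing := by
    intro z
    obtain ⟨r, s, rfl⟩ := IsLocalization.exists_mk'_eq P.ideal.primeCompl z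
    exact ⟨r, s.1, fun h => s.2 (P.mem_ideal.2 h), hmk r s⟩
  have hbij : Function.Bijective (φ.codRestrict P.localRing hmem) := by
    constructor
    · intro z w h
      have hinj : Function.Injective φ :=
        (IsLocalization.lift_injective_iff hu).2 fun a b => by
          rw [(IsLocalization.injective (Localization.AtPrime P.ideal)
            P.ideal.primeCompl_le_nonZeroDivisors).eq_iff,
            (IsFractionRing.injective (CoordinateRing K q) (FunctionField K q)).eq_iff]
      exact hinj (congrArg Subtype.val h)
    · rintro ⟨f, r, s, hs, rfl⟩
      exact ⟨IsLocalization.mk' _ r (⟨s, fun h => hs (P.mem_ideal.1 h)⟩ : P.ideal.primeCompl),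
        Subtype.ext (hmk r _)⟩
  have := P.isDVR_localization
  exact IsDiscreteValuationRing.RingEquivClass.isDiscreteValuationRing (RingEquiv.ofBijective _ hbij)

/-- The place of the function field at an affine point of the curve. -/
def place : Place K (FunctionField K q) where
  ring := P.localRing
  algebraMap_mem c := ⟨algebraMap K _ c, 1, by simp,
    by rw [map_one, div_one]; exact IsScalarTower.algebraMap_apply K (CoordinateRing K q) _ c⟩
  isDVR := P.isDVR_localRing

end AffinePoint

section

variable (K : Type*) [Field K] (q : ℕ)

variable [Finite K]

/-- The points of the Hermitian curve on the chord `O Y_∞`, which is the line `X = 0`,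
other than `O = (0, 0)` and `Y_∞`. -/
def chordPoints : Finset (AffinePoint K q) :=
  (Set.toFinite {P : AffinePoint K q | P.a = 0 ∧ ¬ (P.a = 0 ∧ P.b = 0)}).toFinset

/-- The divisor `m (Q_1 + ⋯ + Q_{q-1})`, where `Q_1, …, Q_{q-1}` are the points of the
curve on the chord `O Y_∞` other than `O` and `Y_∞`. -/
def chordDivisor [Fact (Nat.card K = q ^ 2)] (m : ℕ) : Divisor K (FunctionField K q) :=
  (m : ℤ) • ∑ Q ∈ chordPoints K q, Finsupp.single Q.place 1

end

end Hermitian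

end

noncomputable section

open Polynomial

set_option linter.unusedSectionVars false

/-! ### Valuation rings and orders at an arbitrary place. -/

namespace Place

variable {K F : Type*} [Field K] [Field F] [Algebra K F]

/-! Multiplying by `x ^ m` clears the poles allowed at the `Q_i`: for `f` in `L(G)`, the function `f
* x ^ m` is regular at every place where `x` and `y` are. The affine coordinate ring is Dedekind, so
`f * x ^ m = p(x, y)` with `p` of degree at most `q` in `X` (`exists_eq_algebraMap_of_forall_place`,
`exists_aeval_eq`). At `O` the orders of `x` and `y` are `1` and `q + 1`; at `Y_∞` their pole orders
are `q` and `q + 1`. For monomials `X^i Y^j` with `i ≤ q`, either weight `i + j(q + 1)` or `iq + j(q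
+ 1)` determines `(i, j)`, so leading terms cannot cancel and every monomial of `p` obeys the bounds
known for `p(x, y)` (`exp_vanishingOrder_le`, `exp_poleOrder_le`). Regularity of `f` at `O` and
`Y_∞` then gives `i + j(q + 1) ≥ m` and `iq + j(q + 1) ≤ mq`. The second bound forces `i + j ≤ m`,
strictly if `j > 0`; the first leaves only `X^m` when `j = 0`. Hence `p = Y g + ε X^m` with `deg g ≤
m - 2`.

Conversely, `y` vanishes at `O` to order `q + 1 ≥ m`, and at infinity `y g` has pole order at most
`(m - 1)(q + 1) ≤ mq`, that of `x ^ m`; away from `O`, the `Q_i` and infinity, `x` is a unit. The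
dimension is that of the pairs `(g, ε)`, since the monomials with `i ≤ q` are linearly independent.
-/

theorem ext_ring {P Q : Place K F} (h : P.ring = Q.ring) : P = Q := by
  cases P; cases Q; cases h; rfl

variable (P : Place K F)

theorem mem_ring_iff {f : F} : f ∈ P.ring ↔ P.valuation f ≤ 1 := by
  constructor
  · intro h
    exact (IsDiscreteValuationRing.maximalIdeal P.ring).valuation_le_one (⟨f, h⟩ : P.ring)
  · intro h
    obtain ⟨a, rfl⟩ := IsDiscreteValuationRing.exists_lift_of_le_one (A := P.ring) h
    exact a.2

theorem zero_le_ord_iff {f : F} (hf : f ≠ 0) : 0 ≤ P.ord f ↔ f ∈ P.ring := by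
  have := P.zero_le_ord_add_iff hf 0
  rwa [add_zero, WithZero.exp_zero, ← mem_ring_iff] at this

theorem valuation_algebraMap {c : K} (hc : c ≠ 0) : P.valuation (algebraMap K F c) = 1 := by
  have h (d : K) : P.valuation (algebraMap K F d) ≤ 1 := P.mem_ring_iff.1 (P.algebraMap_mem d)
  refine le_antisymm (h c) ?_
  have h1 : P.valuation (algebraMap K F c⁻¹) * P.valuation (algebraMap K F c) = 1 := by
    rw [← map_mul, ← map_mul, inv_mul_cancel₀ hc, map_one, map_one]
  rw [← h1]
  exact mul_le_of_le_one_left' (h _)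

theorem valuation_eq_of_generator {t : F} (ht : t ∈ P.ring) (ht0 : t ≠ 0)
    (h : IsLocalRing.maximalIdeal P.ring = Ideal.span {⟨t, ht⟩}) :
    P.valuation t = WithZero.exp (-1 : ℤ) := by
  have h0 : (⟨t, ht⟩ : P.ring) ≠ 0 := fun h => ht0 (congrArg Subtype.val h)
  have := (IsDiscreteValuationRing.maximalIdeal P.ring).intValuation_singleton h0 h
  rw [← (IsDiscreteValuationRing.maximalIdeal P.ring).valuation_of_algebraMap (K := F)] at this
  exact this

/-- The local parameter `t` turns the order condition at a place into membership in its ring. -/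
theorem zero_le_ord_add_iff_mul_pow_mem {t f : F} (ht : P.valuation t = WithZero.exp (-1 : ℤ))
    (hf : f ≠ 0) (n : ℕ) : 0 ≤ P.ord f + n ↔ f * t ^ n ∈ P.ring := by
  rw [P.zero_le_ord_add_iff hf, mem_ring_iff, map_mul, map_pow, ht, ← WithZero.exp_nsmul]
  rw [← mul_le_mul_iff_left₀ (a := WithZero.exp (n • (-1 : ℤ))) (by simp), ← WithZero.exp_add]
  simp

end Place

theorem Divisor.degree_sum {K F ι : Type*} [Field K] [Field F] [Algebra K F]
    (s : Finset ι) (P : ι → Place K F) (n : ℤ) :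
    Divisor.degree (n • ∑ i ∈ s, Finsupp.single (P i) (1 : ℤ)) =
      n * ∑ i ∈ s, ((P i).degree : ℤ) := by
  classical
  rw [Divisor.degree, Finsupp.sum_smul_index (by simp), Finset.mul_sum,
    ← Finsupp.sum_finsetSum_index (by simp) (by intros; ring)]
  simp

namespace Hermitian

section

variable (K : Type*) [Field K] (q : ℕ) [Finite K] [hK : Fact (Nat.card K = q ^ 2)]

theorem equation_x_y : y K q ^ q + y K q = x K q ^ (q + 1) := by
  rw [x, y, ← map_pow, ← map_pow, ← map_add, equation_xR_yR]

end

/-! ### Local parameter and residue field at an affine point. -/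

namespace AffinePoint

variable {K : Type*} [Field K] {q : ℕ} [Finite K] [hK : Fact (Nat.card K = q ^ 2)]
  (P : AffinePoint K q)

theorem algebraMap_mem_localRing (r : CoordinateRing K q) :
    algebraMap _ (FunctionField K q) r ∈ P.localRing :=
  ⟨r, 1, by simp, by simp⟩

theorem algebraMap_ne_zero_of_eval {s : CoordinateRing K q} (hs : P.eval s ≠ 0) :
    algebraMap _ (FunctionField K q) s ≠ 0 := by
  intro h0
  rw [FaithfulSMul.algebraMap_eq_zero_iff] at h0
  exact hs (by simp [h0])

theorem inv_algebraMap_mem_localRing {s : CoordinateRing K q} (hs : P.eval s ≠ 0) :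
    (algebraMap _ (FunctionField K q) s)⁻¹ ∈ P.localRing :=
  ⟨1, s, hs, by simp⟩

theorem x_mem_localRing : x K q ∈ P.localRing := P.algebraMap_mem_localRing _

theorem y_mem_localRing : y K q ∈ P.localRing := P.algebraMap_mem_localRing _

theorem const_mem_localRing (c : K) : algebraMap K (FunctionField K q) c ∈ P.localRing :=
  P.place.algebraMap_mem c

/-- The local parameter `x - a` at the point `(a, b)`. -/
def param : FunctionField K q := x K q - algebraMap K _ P.a

theorem param_eq : P.param = algebraMap _ (FunctionField K q) (xR K q - algebraMap K _ P.a) := by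
  rw [param, x, map_sub, ← IsScalarTower.algebraMap_apply]

theorem param_ne_zero : P.param ≠ 0 := by
  rw [param_eq, ne_eq, FaithfulSMul.algebraMap_eq_zero_iff]
  exact P.xR_sub_ne_zero

/-- The ideal of the point is generated by `x - a` and `y - b`, and by `exists_smooth` the second
generator is a multiple of the first in the local ring. -/
theorem exists_eq_param_mul_of_eval_eq_zero {r : CoordinateRing K q} (hr : P.eval r = 0) :
    ∃ g ∈ P.localRing, algebraMap _ (FunctionField K q) r = P.param * g := by
  obtain ⟨u, h, hu, huh⟩ := P.exists_smooth
  obtain ⟨c, d, hcd⟩ := Ideal.mem_span_pair.1 (P.ideal_le (P.mem_ideal.2 hr))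
  have hu0 := P.algebraMap_ne_zero_of_eval hu
  refine ⟨algebraMap _ _ c + algebraMap _ _ (d * h) * (algebraMap _ _ u)⁻¹,
    add_mem (P.algebraMap_mem_localRing _) (mul_mem (P.algebraMap_mem_localRing _)
      (P.inv_algebraMap_mem_localRing hu)), ?_⟩
  have huh' := congrArg (algebraMap _ (FunctionField K q)) huh
  have hcd' := congrArg (algebraMap _ (FunctionField K q)) hcd
  rw [map_mul, map_mul, ← param_eq] at huh'
  rw [map_add, map_mul, map_mul, ← param_eq] at hcd'
  rw [map_mul, ← hcd']
  field_simp
  linear_combination (algebraMap _ (FunctionField K q) d) * huh'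

theorem exists_eq_param_mul_or {f : FunctionField K q} (hf : f ∈ P.localRing) :
    (∃ g ∈ P.localRing, f = P.param * g) ∨ f⁻¹ ∈ P.localRing := by
  obtain ⟨r, s, hs, rfl⟩ := hf
  by_cases hr : P.eval r = 0
  · obtain ⟨g, hg, h⟩ := P.exists_eq_param_mul_of_eval_eq_zero hr
    refine Or.inl ⟨g * (algebraMap _ _ s)⁻¹, mul_mem hg (P.inv_algebraMap_mem_localRing hs), ?_⟩
    rw [h, div_eq_mul_inv, mul_assoc]
  · exact Or.inr ⟨s, r, hr, inv_div _ _⟩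

theorem eval_eq_zero_of_eq_param_mul {r : CoordinateRing K q} {g : FunctionField K q}
    (hg : g ∈ P.localRing) (h : algebraMap _ (FunctionField K q) r = P.param * g) :
    P.eval r = 0 := by
  obtain ⟨c, s, hs, rfl⟩ := hg
  have hs0 := P.algebraMap_ne_zero_of_eval hs
  rw [param_eq, ← mul_div_assoc, eq_div_iff hs0, ← map_mul, ← map_mul] at h
  have h2 := congrArg P.eval (IsFractionRing.injective (CoordinateRing K q) (FunctionField K q) h)
  rw [map_mul, map_mul, map_sub, eval_xR, eval_algebraMap, sub_self, zero_mul] at h2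
  exact (mul_eq_zero.1 h2).resolve_right hs

theorem inv_param_notMem : P.param⁻¹ ∉ P.localRing := by
  intro h
  have := P.eval_eq_zero_of_eq_param_mul (r := 1) h (by
    rw [map_one, mul_inv_cancel₀ P.param_ne_zero])
  simp at this

theorem param_mem : P.param ∈ P.localRing := by
  rw [param_eq]
  exact P.algebraMap_mem_localRing _

theorem valuation_param : P.place.valuation P.param = WithZero.exp (-1 : ℤ) := by
  refine P.place.valuation_eq_of_generator P.param_mem P.param_ne_zero ?_
  refine le_antisymm ?_ ?_
  · rintro ⟨f, hf⟩ hm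
    rcases P.exists_eq_param_mul_or hf with ⟨g, hg, h⟩ | h
    · rw [Ideal.mem_span_singleton]
      exact ⟨⟨g, hg⟩, Subtype.ext h⟩
    · by_cases hf0 : f = 0
      · subst hf0
        exact zero_mem _
      · rw [IsLocalRing.mem_maximalIdeal, mem_nonunits_iff] at hm
        exact absurd (IsUnit.of_mul_eq_one ⟨f⁻¹, h⟩ (Subtype.ext (mul_inv_cancel₀ hf0))) hm
  · rw [Ideal.span_singleton_le_iff_mem, IsLocalRing.mem_maximalIdeal, mem_nonunits_iff]
    intro hu
    obtain ⟨⟨g, hg⟩, h⟩ := hu.exists_right_inv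
    have h' : P.param * g = 1 := congrArg Subtype.val h
    exact P.inv_param_notMem (by rw [← eq_inv_of_mul_eq_one_right h']; exact hg)

/-- A quotient `r / s` differs from its value at the point by a multiple of the local parameter, so
`K` surjects onto the residue field. -/
theorem degree_place : P.place.degree = 1 := by
  have key : Function.Surjective (algebraMap K (IsLocalRing.ResidueField P.place.ring)) := by
    intro z
    obtain ⟨⟨f, hf⟩, rfl⟩ := IsLocalRing.residue_surjective z
    obtain ⟨r, s, hs, rfl⟩ := id hf
    refine ⟨P.eval r / P.eval s, ?_⟩
    set c := P.eval r / P.eval s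
    rw [IsScalarTower.algebraMap_apply K P.place.ring, IsLocalRing.ResidueField.algebraMap_eq,
      ← sub_eq_zero, ← map_sub, IsLocalRing.residue_eq_zero_iff, IsLocalRing.mem_maximalIdeal,
      mem_nonunits_iff]
    intro hu
    have hz : P.eval (algebraMap K _ c * s - r) = 0 := by
      rw [map_sub, map_mul, eval_algebraMap, div_mul_cancel₀ _ hs, sub_self]
    obtain ⟨g, hg, h⟩ := P.exists_eq_param_mul_of_eval_eq_zero hz
    obtain ⟨⟨w, hw⟩, h1⟩ := hu.exists_right_inv
    have h2 : (algebraMap K (FunctionField K q) c - algebraMap _ (FunctionField K q) r /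
      algebraMap _ (FunctionField K q) s) * w = 1 := congrArg Subtype.val h1
    have hs0 := P.algebraMap_ne_zero_of_eval hs
    rw [map_sub, map_mul, ← IsScalarTower.algebraMap_apply] at h
    refine P.inv_param_notMem ?_
    have h3 : P.param * (g * (algebraMap _ (FunctionField K q) s)⁻¹ * w) = 1 := by
      rw [← h2, ← mul_assoc, ← mul_assoc, ← h]
      field_simp
    rw [← eq_inv_of_mul_eq_one_right h3]
    exact mul_mem (mul_mem hg (P.inv_algebraMap_mem_localRing hs)) hw
  rw [Place.degree]
  refine finrank_eq_one (R := K) (1 : IsLocalRing.ResidueField P.place.ring)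
    one_ne_zero fun w => ?_
  obtain ⟨c, rfl⟩ := key w
  exact ⟨c, by rw [Algebra.algebraMap_eq_smul_one]⟩

/-- The local ring detects vanishing: a regular function is zero at the point exactly when its
inverse is not in the ring. Applied to `x - a` and `y - b`, this recovers the coordinates. -/
theorem localRing_injective : Function.Injective
    fun P : AffinePoint K q => P.localRing := by
  intro P Q h
  change P.localRing = Q.localRing at h
  have key (r : CoordinateRing K q) (hr : P.eval r = 0) : Q.eval r = 0 := by
    obtain ⟨g, hg, hrg⟩ := P.exists_eq_param_mul_of_eval_eq_zero hr
    by_contra hQ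
    have hinv := Q.inv_algebraMap_mem_localRing hQ
    rw [← h] at hinv
    have h0 := Q.algebraMap_ne_zero_of_eval hQ
    refine P.inv_param_notMem ?_
    have h1 : P.param * (g * (algebraMap _ (FunctionField K q) r)⁻¹) = 1 := by
      rw [← mul_assoc, ← hrg, mul_inv_cancel₀ h0]
    rw [← eq_inv_of_mul_eq_one_right h1]
    exact mul_mem hg hinv
  have ha := key (xR K q - algebraMap K _ P.a) (by simp)
  have hb := key (yR K q - algebraMap K _ P.b) (by simp)
  rw [map_sub, eval_algebraMap, eval_xR, sub_eq_zero] at ha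
  rw [map_sub, eval_algebraMap, eval_yR, sub_eq_zero] at hb
  exact AffinePoint.ext ha.symm hb.symm

theorem place_injective : Function.Injective
    fun P : AffinePoint K q => P.place :=
  fun _ _ h => localRing_injective (congrArg Place.ring h)

end AffinePoint

/-! ### Polynomial representatives, and recognising the place at an affine point. -/

section

variable (K : Type*) [Field K] (q : ℕ)

/-- Every regular function is a polynomial in `x` and `y` of degree at most `q` in `x`. -/
theorem exists_aeval_eq (r : CoordinateRing K q) : ∃ p : MvPolynomial (Fin 2) K,
    (∀ d ∈ p.support, d 0 ≤ q) ∧ MvPolynomial.aeval ![xR K q, yR K q] p = r := by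
  have hmon := monic_equation K q
  -- The remainder modulo the equation, which is monic of degree `q + 1` in `X`.
  set r₀ := AdjoinRoot.modByMonicHom hmon r with hr₀
  refine ⟨∑ i ∈ Finset.range (q + 1), ∑ j ∈ (r₀.coeff i).support,
    MvPolynomial.monomial (Finsupp.single 0 i + Finsupp.single 1 j) ((r₀.coeff i).coeff j),
    ?_, ?_⟩
  · suffices h : _ ∈ MvPolynomial.restrictSupport K {d : Fin 2 →₀ ℕ | d 0 ≤ q} from
      fun d hd => (MvPolynomial.mem_restrictSupport_iff K).1 h hd
    refine Submodule.sum_mem _ fun i hi => Submodule.sum_mem _ fun j _ => ?_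
    rw [MvPolynomial.monomial_mem_restrictSupport]
    left
    have := Finset.mem_range.1 hi
    simp
    omega
  · have hne : equation K q ≠ 1 := fun h => by
      have := natDegree_equation K q
      rw [h] at this
      simp at this
    have hdeg : r₀.natDegree < q + 1 := by
      obtain ⟨p, rfl⟩ := AdjoinRoot.mk_surjective r
      rw [hr₀, AdjoinRoot.modByMonicHom_mk, ← natDegree_equation K q]
      exact natDegree_modByMonic_lt _ hmon hne
    have h1 : r = AdjoinRoot.mk (equation K q) r₀ := (AdjoinRoot.mk_leftInverse hmon r).symm
    conv_rhs => rw [h1, r₀.as_sum_range' _ hdeg]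
    rw [map_sum, map_sum]
    refine Finset.sum_congr rfl fun i _ => ?_
    rw [← C_mul_X_pow_eq_monomial, map_mul, AdjoinRoot.mk_C, map_pow, AdjoinRoot.mk_X]
    conv_rhs => rw [(r₀.coeff i).as_sum_support]
    rw [map_sum, map_sum, Finset.sum_mul]
    refine Finset.sum_congr rfl fun j _ => ?_
    rw [MvPolynomial.aeval_monomial, Finsupp.prod_fintype _ _ (by simp),
      ← C_mul_X_pow_eq_monomial, map_mul, map_pow, Fin.prod_univ_two, AdjoinRoot.algebraMap_eq']
    simp [xR, yR]
    ring

end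

section

variable {K : Type*} [Field K] {q : ℕ} [Finite K] [hK : Fact (Nat.card K = q ^ 2)]

theorem algebraMap_aeval (p : MvPolynomial (Fin 2) K) :
    algebraMap _ (FunctionField K q) (MvPolynomial.aeval ![xR K q, yR K q] p) =
      MvPolynomial.aeval ![x K q, y K q] p := by
  rw [← MvPolynomial.aeval_algebraMap_apply]
  congr 2
  ext i
  fin_cases i <;> rfl

theorem _root_.Place.aeval_mem {F : Type*} [Field F] [Algebra K F] (Q : Place K F) {s t : F}
    (hs : s ∈ Q.ring) (ht : t ∈ Q.ring)
    (p : MvPolynomial (Fin 2) K) : MvPolynomial.aeval ![s, t] p ∈ Q.ring := by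
  induction p using MvPolynomial.induction_on with
  | C a => rw [MvPolynomial.aeval_C]; exact Q.algebraMap_mem a
  | add p p' h h' => rw [map_add]; exact add_mem h h'
  | mul_X p i h =>
    rw [map_mul, MvPolynomial.aeval_X]
    refine mul_mem h ?_
    fin_cases i
    · exact hs
    · exact ht

theorem algebraMap_mem_of_x_mem_of_y_mem {Q : Place K (FunctionField K q)}
    (hx : x K q ∈ Q.ring) (hy : y K q ∈ Q.ring) (r : CoordinateRing K q) :
    algebraMap _ (FunctionField K q) r ∈ Q.ring := by
  obtain ⟨p, -, rfl⟩ := exists_aeval_eq K q r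
  rw [algebraMap_aeval]
  exact Q.aeval_mem hx hy p

/-- A place at which `x - a` and `y - b` both vanish is the place at `(a, b)`. -/
theorem AffinePoint.eq_place (P : AffinePoint K q) {Q : Place K (FunctionField K q)}
    (hx : Q.valuation (x K q - algebraMap K _ P.a) < 1)
    (hy : Q.valuation (y K q - algebraMap K _ P.b) < 1) : Q = P.place := by
  have hxm : x K q ∈ Q.ring := by
    simpa using add_mem (Q.mem_ring_iff.2 hx.le) (Q.algebraMap_mem P.a)
  have hym : y K q ∈ Q.ring := by
    simpa using add_mem (Q.mem_ring_iff.2 hy.le) (Q.algebraMap_mem P.b)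
  have hR (r : CoordinateRing K q) : Q.valuation (algebraMap _ (FunctionField K q) r) ≤ 1 :=
    Q.mem_ring_iff.1 (algebraMap_mem_of_x_mem_of_y_mem hxm hym r)
  have hlt (r : CoordinateRing K q) (hr : P.eval r = 0) :
      Q.valuation (algebraMap _ (FunctionField K q) r) < 1 := by
    obtain ⟨c, d, rfl⟩ := Ideal.mem_span_pair.1 (P.ideal_le (P.mem_ideal.2 hr))
    rw [map_add, map_mul, map_mul, map_sub, map_sub, ← IsScalarTower.algebraMap_apply,
      ← IsScalarTower.algebraMap_apply]
    refine Valuation.map_add_lt _ ?_ ?_ <;> rw [map_mul]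
    · exact (mul_le_of_le_one_left' (hR c)).trans_lt hx
    · exact (mul_le_of_le_one_left' (hR d)).trans_lt hy
  have hone (s : CoordinateRing K q) (hs : P.eval s ≠ 0) :
      Q.valuation (algebraMap _ (FunctionField K q) s) = 1 := by
    have h1 := hlt (s - algebraMap K _ (P.eval s)) (by simp)
    rw [map_sub, ← IsScalarTower.algebraMap_apply] at h1
    have h2 := Q.valuation_algebraMap hs
    have h3 := Valuation.map_add_eq_of_lt_left Q.valuation (h1.trans_eq h2.symm)
    rwa [add_sub_cancel, h2] at h3
  have hle : P.localRing ≤ Q.ring := by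
    rintro _ ⟨r, s, hs, rfl⟩
    rw [Q.mem_ring_iff, map_div₀, hone s hs, div_one]
    exact hR r
  -- A discrete valuation ring is maximal among proper subrings: if `f` in `Q.ring` were outside
  -- `P.localRing`, then `f⁻¹` would be a multiple of `x - a`, hence of valuation less than `1` at
  -- `Q`.
  refine Place.ext_ring (le_antisymm (fun f hf => ?_) hle)
  rcases P.localRing.mem_or_inv_mem f with h | h
  · exact h
  · rcases P.exists_eq_param_mul_or h with ⟨g, hg, hfg⟩ | h'
    · by_cases hf0 : f = 0
      · rw [hf0]; exact zero_mem _
      exfalso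
      have h1 : Q.valuation (f⁻¹) < 1 := by
        rw [hfg, map_mul]
        exact (mul_le_of_le_one_right' (Q.mem_ring_iff.1 (hle hg))).trans_lt hx
      rw [map_inv₀] at h1
      have h2 := Q.mem_ring_iff.1 hf
      exact absurd h1 (not_lt.2 ((one_le_inv₀ (zero_lt_iff.2 ((Valuation.ne_zero_iff _).2 hf0))).2 h2))
    · rwa [inv_inv] at h'

end

end Hermitian

/-! ### The points of the line `X = 0` and the chord divisor. -/

namespace Hermitian

section

variable (K : Type*) [Field K] (q : ℕ) [Finite K] [hK : Fact (Nat.card K = q ^ 2)]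

/-- Since `q ^ 2` is a power of the characteristic, so is `q`, and raising to the power `q` is an
iterated Frobenius. -/
theorem add_pow_q {A : Type*} [CommRing A] [Algebra K A] (a b : A) :
    (a + b) ^ q = a ^ q + b ^ q := by
  have := Fintype.ofFinite K
  obtain ⟨p, hp⟩ := CharP.exists K
  obtain ⟨n, hprime, hn⟩ := FiniteField.card K p
  rw [← Nat.card_eq_fintype_card, hK.out] at hn
  obtain ⟨k, -, rfl⟩ := (Nat.dvd_prime_pow hprime).1 (hn ▸ dvd_pow_self q two_ne_zero)
  rcases subsingleton_or_nontrivial A with h | h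
  · exact Subsingleton.elim _ _
  have : CharP A p := charP_of_injective_algebraMap (algebraMap K A).injective p
  have := Fact.mk hprime
  exact add_pow_char_pow a b p k

theorem monic_X_pow_add_X : (X ^ q + X : K[X]).Monic := by
  have := two_le K q
  refine monic_X_pow_add ?_
  rw [degree_X]
  exact_mod_cast (by omega : 1 < q)

theorem natDegree_X_pow_add_X : (X ^ q + X : K[X]).natDegree = q := by
  have := two_le K q
  rw [natDegree_add_eq_left_of_natDegree_lt] <;> simp
  omega

/-- With `L = X ^ q + X` one has `L ^ q - L = X ^ (q ^ 2) - X`. Thus `L` inherits simple roots, all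
in `K`, which is why the chord points are rational and `q - 1` in number. -/
theorem X_pow_add_X_dvd : (X ^ q + X : K[X]) ∣ X ^ Nat.card K - X := by
  have hq := two_le K q
  have h : (X ^ Nat.card K - X : K[X]) = (X ^ q + X) ^ q - (X ^ q + X) := by
    rw [add_pow_q K q, hK.out, ← pow_mul]
    ring
  rw [h]
  exact dvd_sub (dvd_pow_self _ (by omega)) dvd_rfl

theorem splits_X_pow_add_X : (X ^ q + X : K[X]).Splits := by
  have := Fintype.ofFinite K
  have h1 : (X ^ Nat.card K - X : K[X]).Splits := by
    rw [splits_iff_card_roots, Nat.card_eq_fintype_card, FiniteField.roots_X_pow_card_sub_X,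
      FiniteField.X_pow_card_sub_X_natDegree_eq K Fintype.one_lt_card]
    rfl
  refine h1.of_dvd ?_ (X_pow_add_X_dvd K q)
  rw [Nat.card_eq_fintype_card]
  exact FiniteField.X_pow_card_sub_X_ne_zero K Fintype.one_lt_card

theorem nodup_roots_X_pow_add_X : (X ^ q + X : K[X]).roots.Nodup := by
  have := Fintype.ofFinite K
  refine Multiset.nodup_of_le (Polynomial.roots.le_of_dvd ?_ (X_pow_add_X_dvd K q)) ?_
  · rw [Nat.card_eq_fintype_card]
    exact FiniteField.X_pow_card_sub_X_ne_zero K Fintype.one_lt_card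
  · rw [Nat.card_eq_fintype_card, FiniteField.roots_X_pow_card_sub_X]
    exact Finset.univ.nodup

/-- The solutions of `b ^ q + b = 0`. -/
def kernelRoots : Finset K := ⟨(X ^ q + X : K[X]).roots, nodup_roots_X_pow_add_X K q⟩

variable {K q} in
theorem mem_kernelRoots {b : K} : b ∈ kernelRoots K q ↔ b ^ q + b = 0 := by
  rw [← Finset.mem_val, kernelRoots, mem_roots (monic_X_pow_add_X K q).ne_zero]
  simp

theorem card_kernelRoots : (kernelRoots K q).card = q := by
  have := (splits_iff_card_roots.1 (splits_X_pow_add_X K q))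
  rw [natDegree_X_pow_add_X] at this
  exact this

theorem prod_X_sub_C_kernelRoots : ∏ b ∈ kernelRoots K q, (X - C b) = (X ^ q + X : K[X]) :=
  ((splits_X_pow_add_X K q).eq_prod_roots_of_monic (monic_X_pow_add_X K q)).symm

variable {K q} in
theorem zero_mem_kernelRoots : (0 : K) ∈ kernelRoots K q := by
  have := two_le K q
  rw [mem_kernelRoots, zero_pow (by omega), zero_add]

variable {K q} in
/-- The point `(0, b)` of the curve. -/
def chordPoint (b : kernelRoots K q) : AffinePoint K q :=
  ⟨0, b, by rw [mem_kernelRoots.1 b.2, zero_pow (by omega)]⟩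

theorem mem_chordPoints {P : AffinePoint K q} :
    P ∈ chordPoints K q ↔ P.a = 0 ∧ P.b ≠ 0 := by
  rw [chordPoints, Set.Finite.mem_toFinset, Set.mem_ofPred_eq]
  tauto

theorem card_chordPoints : (chordPoints K q).card = q - 1 := by
  classical
  rw [← card_kernelRoots K q, ← Finset.card_erase_of_mem zero_mem_kernelRoots, card_kernelRoots]
  refine Finset.card_bij (fun P _ => P.b) ?_ ?_ ?_
  · intro P hP
    rw [mem_chordPoints] at hP
    rw [Finset.mem_erase, mem_kernelRoots, P.on_curve, hP.1, zero_pow (by omega)]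
    exact ⟨hP.2, rfl⟩
  · intro P hP Q hQ h
    rw [mem_chordPoints] at hP hQ
    exact AffinePoint.ext (hP.1.trans hQ.1.symm) h
  · intro b hb
    rw [Finset.mem_erase] at hb
    exact ⟨chordPoint ⟨b, hb.2⟩, (mem_chordPoints K q).2 ⟨rfl, hb.1⟩, rfl⟩

theorem degree_chordDivisor (m : ℕ) : (chordDivisor K q m).degree = m * ((q : ℤ) - 1) := by
  have := two_le K q
  rw [chordDivisor, Divisor.degree_sum]
  simp only [AffinePoint.degree_place, Finset.sum_const, card_chordPoints]
  rw [nsmul_eq_mul, Nat.cast_one, mul_one, Nat.cast_sub (by omega), Nat.cast_one]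

variable {K q}

theorem chordDivisor_place {Q : AffinePoint K q} (hQ : Q ∈ chordPoints K q) (m : ℕ) :
    chordDivisor K q m Q.place = m := by
  classical
  rw [chordDivisor, Finsupp.smul_apply, Finsupp.finsetSum_apply, Finset.sum_eq_single Q]
  · simp
  · intro P _ hPQ
    exact Finsupp.single_eq_of_ne fun h => hPQ (AffinePoint.place_injective h.symm)
  · exact fun h => absurd hQ h

theorem chordDivisor_eq_zero {P : Place K (FunctionField K q)}
    (h : ∀ Q ∈ chordPoints K q, P ≠ Q.place) (m : ℕ) : chordDivisor K q m P = 0 := by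
  classical
  rw [chordDivisor, Finsupp.smul_apply, Finsupp.finsetSum_apply, Finset.sum_eq_zero, smul_zero]
  exact fun Q hQ => Finsupp.single_eq_of_ne (h Q hQ)

/-- Membership in the Riemann–Roch space of the chord divisor in terms of valuation rings. -/
theorem mem_riemannRochSpace_chordDivisor {f : FunctionField K q} {m : ℕ} :
    f ∈ riemannRochSpace (chordDivisor K q m) ↔
      (∀ Q ∈ chordPoints K q, f * x K q ^ m ∈ Q.localRing) ∧
      ∀ P : Place K (FunctionField K q), (∀ Q ∈ chordPoints K q, P ≠ Q.place) → f ∈ P.ring := by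
  have hmem : f ∈ riemannRochSpace (chordDivisor K q m) ↔
    f = 0 ∨ ∀ P : Place K (FunctionField K q), 0 ≤ P.ord f + chordDivisor K q m P := Iff.rfl
  rw [hmem]
  by_cases hf : f = 0
  · simp [hf, zero_mem]
  have hQ (Q) (hQ : Q ∈ chordPoints K q) :
      0 ≤ Q.place.ord f + chordDivisor K q m Q.place ↔ f * x K q ^ m ∈ Q.localRing := by
    have hv := Q.valuation_param
    rw [AffinePoint.param, ((mem_chordPoints K q).1 hQ).1, map_zero, sub_zero] at hv
    rw [chordDivisor_place hQ]
    exact Q.place.zero_le_ord_add_iff_mul_pow_mem hv hf m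
  have hP (P) (hP : ∀ Q ∈ chordPoints K q, P ≠ Q.place) :
      0 ≤ P.ord f + chordDivisor K q m P ↔ f ∈ P.ring := by
    rw [chordDivisor_eq_zero hP, add_zero, P.zero_le_ord_iff hf]
  constructor
  · intro h
    have h := h.resolve_left hf
    exact ⟨fun Q hm => (hQ Q hm).1 (h _), fun P hm => (hP P hm).1 (h _)⟩
  · rintro ⟨h1, h2⟩
    refine Or.inr fun P => ?_
    by_cases hc : ∀ Q ∈ chordPoints K q, P ≠ Q.place
    · exact (hP P hc).2 (h2 P hc)
    · push Not at hc
      obtain ⟨Q, hm, rfl⟩ := hc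
      exact (hQ Q hm).2 (h1 Q hm)

end

end Hermitian

/-! ### The coordinate ring is a Dedekind domain. -/

namespace Hermitian

section

variable (K : Type*) [Field K] (q : ℕ)

instance : Module.Finite K[X] (CoordinateRing K q) := (monic_equation K q).finite_adjoinRoot

theorem algebraMap_X_eq_yR : algebraMap K[X] (CoordinateRing K q) X = yR K q := rfl

variable [Finite K] [hK : Fact (Nat.card K = q ^ 2)]

theorem algebraMap_polynomial_injective :
    Function.Injective (algebraMap K[X] (CoordinateRing K q)) := by
  refine AdjoinRoot.of.injective_of_degree_ne_zero ?_
  rw [degree_eq_natDegree (monic_equation K q).ne_zero, natDegree_equation]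
  exact_mod_cast Nat.succ_ne_zero q

instance : FaithfulSMul K[X] (CoordinateRing K q) :=
  (faithfulSMul_iff_algebraMap_injective _ _).2 (algebraMap_polynomial_injective K q)

/-- The ring is integral over the principal ideal domain `K[Y]`, so a nonzero prime contracts to a
nonzero, hence maximal, prime. -/
instance : Ring.DimensionLEOne (CoordinateRing K q) where
  maximalOfPrime {p} hp hprime := by
    refine Ideal.isMaximal_of_isIntegral_of_isMaximal_comap (R := K[X]) p ?_
    have := hprime.under K[X]
    exact Ideal.IsPrime.isMaximal (inferInstanceAs (p.under K[X]).IsPrime)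
      (mt Ideal.eq_bot_of_comap_eq_bot hp)

section Discriminant

variable (k : Type*) [Field k] [Algebra K[X] k] [IsFractionRing K[X] k]
  [Algebra k (FunctionField K q)] [IsScalarTower K[X] k (FunctionField K q)]

theorem minpoly_x : minpoly k (x K q) = X ^ (q + 1) - C (algebraMap K[X] k (X ^ q + X)) := by
  have h1 : X ^ (q + 1) - C (algebraMap K[X] k (X ^ q + X)) =
      (equation K q).map (algebraMap K[X] k) := by
    rw [equation, Polynomial.map_sub, Polynomial.map_pow, map_X, map_C]
  rw [h1]
  symm
  refine minpoly.eq_of_irreducible_of_monic ?_ ?_ ((monic_equation K q).map _)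
  · exact ((monic_equation K q).irreducible_iff_irreducible_map_fraction_map).1
      (irreducible_equation K q)
  · rw [aeval_map_algebraMap, x, aeval_algebraMap_apply, xR, AdjoinRoot.aeval_eq,
      AdjoinRoot.mk_self, map_zero]

/-- As `q = 0` in `K`, the factor `q + 1` is `1`. The nonvanishing of this value gives separability
over `K(y)`, and its norm gives the discriminant of the powers of `x`. -/
theorem aeval_derivative_minpoly_x :
    aeval (x K q) (minpoly k (x K q)).derivative = x K q ^ q := by
  have hq : (q : k) = 0 := by
    rw [← map_natCast (algebraMap K[X] k), ← map_natCast C, cast_q_eq_zero K q, map_zero, map_zero]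
  rw [minpoly_x, derivative_sub, derivative_C, derivative_X_pow, sub_zero, Nat.cast_add, hq]
  simp

theorem x_ne_zero : x K q ≠ 0 := by
  have h : xR K q ≠ 0 := by
    refine AdjoinRoot.mk_ne_zero_of_natDegree_lt (monic_equation K q) X_ne_zero ?_
    rw [natDegree_X, natDegree_equation]
    have := two_le K q
    omega
  rwa [x, ne_eq, FaithfulSMul.algebraMap_eq_zero_iff]

theorem isIntegral_x : IsIntegral K[X] (x K q) :=
  (Algebra.IsIntegral.isIntegral (R := K[X]) (xR K q)).algebraMap

theorem algebraMap_mem_adjoin_x (r : CoordinateRing K q) :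
    algebraMap _ (FunctionField K q) r ∈ Algebra.adjoin K[X] {x K q} := by
  obtain ⟨p, rfl⟩ := AdjoinRoot.mk_surjective r
  rw [← AdjoinRoot.aeval_eq, ← aeval_algebraMap_apply]
  exact aeval_mem_adjoin_singleton _ _

theorem adjoin_x_eq_top : IntermediateField.adjoin k {x K q} = ⊤ := by
  have hle : ∀ r : CoordinateRing K q,
      algebraMap _ (FunctionField K q) r ∈ IntermediateField.adjoin k {x K q} := by
    intro r
    have h := algebraMap_mem_adjoin_x K q r
    refine Algebra.adjoin_le (S := (IntermediateField.adjoin k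
      {x K q}).toSubalgebra.restrictScalars K[X]) ?_ h
    rw [Set.singleton_subset_iff]
    exact IntermediateField.mem_adjoin_simple_self k _
  refine top_unique fun f _ => ?_
  obtain ⟨r, s, -, rfl⟩ := IsFractionRing.div_surjective (A := CoordinateRing K q) f
  exact div_mem (hle r) (hle s)

theorem isSeparable_x : IsSeparable k (x K q) := by
  have hint : IsIntegral k (x K q) := (isIntegral_x K q).tower_top
  refine (separable_iff_derivative_ne_zero (minpoly.irreducible hint)).2 fun h => ?_
  have h1 := aeval_derivative_minpoly_x K q k
  rw [h, map_zero] at h1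
  exact pow_ne_zero q (x_ne_zero K q) h1.symm

theorem isSeparable_functionField : Algebra.IsSeparable k (FunctionField K q) := by
  have h := (IntermediateField.isSeparable_adjoin_simple_iff_isSeparable k
    (FunctionField K q)).2 (isSeparable_x K q k)
  rw [adjoin_x_eq_top] at h
  exact Algebra.IsSeparable.of_algHom k (⊤ : IntermediateField k (FunctionField K q))
    (IntermediateField.topEquiv (F := k) (E := FunctionField K q)).symm.toAlgHom

end Discriminant

variable {K q}

/-- The discriminant of the power basis of `x` over `K(y)` carries integral elements into `K[y][x]`.
Up to sign it is the norm of `x ^ q`, that is `(y ^ q + y) ^ q = x ^ ((q + 1) * q)`. -/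
theorem exists_mul_eq_algebraMap_of_isIntegral {z : FunctionField K q}
    (hz : IsIntegral K[X] z) :
    ∃ r : CoordinateRing K q, algebraMap _ (FunctionField K q) r = x K q ^ ((q + 1) * q) * z := by
  have : FaithfulSMul K[X] (FunctionField K q) := by
    rw [faithfulSMul_iff_algebraMap_injective, IsScalarTower.algebraMap_eq K[X]
      (CoordinateRing K q), RingHom.coe_comp]
    exact (IsFractionRing.injective (CoordinateRing K q) _).comp
      (algebraMap_polynomial_injective K q)
  let k := FractionRing K[X]
  let : Algebra k (FunctionField K q) := FractionRing.liftAlgebra K[X] (FunctionField K q)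
  have : IsScalarTower K[X] k (FunctionField K q) :=
    FractionRing.isScalarTower_liftAlgebra K[X] (FunctionField K q)
  have hint : IsIntegral k (x K q) := (isIntegral_x K q).tower_top
  have htop : Algebra.adjoin k {x K q} = ⊤ := by
    rw [← IntermediateField.adjoin_simple_toSubalgebra_of_isAlgebraic hint.isAlgebraic,
      adjoin_x_eq_top, IntermediateField.top_toSubalgebra]
  let B := PowerBasis.ofAdjoinEqTop hint htop
  have hgen : B.gen = x K q := PowerBasis.ofAdjoinEqTop_gen hint htop
  have := isSeparable_functionField K q k
  have hmem := Algebra.discr_mul_isIntegral_mem_adjoin (R := K[X]) k (B := B)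
    (by rw [hgen]; exact isIntegral_x K q) hz
  have hnorm : Algebra.norm k (x K q) = (-1) ^ B.dim * -algebraMap K[X] k (X ^ q + X) := by
    have h := Algebra.PowerBasis.norm_gen_eq_coeff_zero_minpoly B
    rw [hgen, minpoly_x] at h
    rw [h, coeff_sub, coeff_X_pow, if_neg (by omega), coeff_C_zero, zero_sub]
  rw [Algebra.discr_powerBasis_eq_norm, hgen, aeval_derivative_minpoly_x, map_pow, hnorm] at hmem
  have hxy : algebraMap k (FunctionField K q) (algebraMap K[X] k (X ^ q + X)) =
      x K q ^ (q + 1) := by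
    rw [← IsScalarTower.algebraMap_apply, IsScalarTower.algebraMap_apply K[X]
      (CoordinateRing K q), map_add, map_pow, algebraMap_X_eq_yR, equation_xR_yR, x, map_pow]
  have hsub : Algebra.adjoin K[X] {x K q} ≤
      (IsScalarTower.toAlgHom K[X] (CoordinateRing K q) (FunctionField K q)).range := by
    rw [Algebra.adjoin_le_iff, Set.singleton_subset_iff]
    exact ⟨xR K q, rfl⟩
  have hmem' : x K q ^ ((q + 1) * q) * z ∈ Algebra.adjoin K[X] {x K q} := by
    rw [Algebra.smul_def, map_mul, map_pow, map_pow, map_mul, map_pow, map_neg, map_neg, map_one,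
      hxy, ← neg_one_mul (x K q ^ (q + 1)), mul_pow, mul_pow, ← pow_mul, ← pow_mul] at hmem
    generalize hN : Module.finrank k (FunctionField K q) * _ / 2 = N at hmem
    have hsign : ∀ n : ℕ, ((-1 : FunctionField K q) ^ n) ∈ Algebra.adjoin K[X] {x K q} :=
      fun n => pow_mem (neg_mem (one_mem _)) n
    -- The three summands cancel the signs from the discriminant formula, from the norm, and from
    -- the constant coefficient of the minimal polynomial.
    have h2 := mul_mem (hsign (N + B.dim * q + q)) hmem
    convert h2 using 1
    have h1 : (-1 : FunctionField K q) ^ (N + B.dim * q + q) * (-1) ^ (N + B.dim * q + q) = 1 := by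
      rw [← mul_pow]; simp
    rw [pow_add, pow_add] at h1 ⊢
    linear_combination (- x K q ^ ((q + 1) * q) * z) * h1
  obtain ⟨r, hr⟩ := hsub hmem'
  exact ⟨r, hr⟩

/-- A regular function that vanishes at all affine points of the line `X = 0` is divisible
by `x`. -/
theorem xR_dvd_of_eval_eq_zero {r : CoordinateRing K q}
    (h : ∀ b : kernelRoots K q, (chordPoint b).eval r = 0) : xR K q ∣ r := by
  obtain ⟨p, rfl⟩ := AdjoinRoot.mk_surjective r
  -- Modulo `x` only the coefficient `p.coeff 0` in `K[Y]` survives. It vanishes at all `q` roots of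
  -- `Y ^ q + Y`, and `y ^ q + y` is itself a multiple of `x`.
  have hc : (X ^ q + X : K[X]) ∣ p.coeff 0 := by
    by_cases h0 : p.coeff 0 = 0
    · rw [h0]; exact dvd_zero _
    rw [← prod_X_sub_C_kernelRoots]
    refine (Multiset.prod_X_sub_C_dvd_iff_le_roots h0 (kernelRoots K q).val).2 ?_
    refine (Multiset.le_iff_subset (kernelRoots K q).nodup).2 fun b hb => ?_
    rw [mem_roots h0]
    have := h ⟨b, hb⟩
    rw [AffinePoint.eval, AdjoinRoot.lift_mk] at this
    change eval₂ _ 0 p = 0 at this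
    rwa [eval₂_at_zero] at this
  have hy : xR K q ∣ AdjoinRoot.of (equation K q) (X ^ q + X) := by
    rw [map_add, map_pow]
    exact (equation_xR_yR K q) ▸ dvd_pow_self _ (Nat.succ_ne_zero q)
  rw [← divX_mul_X_add p, map_add, map_mul, AdjoinRoot.mk_X, AdjoinRoot.mk_C]
  exact dvd_add (dvd_mul_left _ _) (hy.trans (map_dvd _ hc))

theorem chordPoint_param (b : kernelRoots K q) : (chordPoint b).param = x K q := by
  rw [AffinePoint.param, chordPoint, map_zero, sub_zero]

/-- Descent on the power of `x`: if `z` is regular on the line `X = 0`, then `x ^ (N + 1) * z`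
vanishes at every affine point of that line, so one factor `x` can be cancelled inside the ring. -/
theorem exists_eq_algebraMap_of_pow_mul {z : FunctionField K q}
    (hz : ∀ b : kernelRoots K q, z ∈ (chordPoint b).localRing) (N : ℕ) :
    (∃ r : CoordinateRing K q, algebraMap _ (FunctionField K q) r = x K q ^ N * z) →
      ∃ r, algebraMap (CoordinateRing K q) (FunctionField K q) r = z := by
  induction N with
  | zero => simp
  | succ N ih =>
    rintro ⟨r, hr⟩
    have hdvd : xR K q ∣ r := xR_dvd_of_eval_eq_zero fun b => by
      refine (chordPoint b).eval_eq_zero_of_eq_param_mul (g := x K q ^ N * z)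
        (mul_mem (pow_mem (AffinePoint.x_mem_localRing _) N) (hz b)) ?_
      rw [hr, chordPoint_param]
      ring
    obtain ⟨r', rfl⟩ := hdvd
    refine ih ⟨r', mul_left_cancel₀ (x_ne_zero K q) ?_⟩
    rw [map_mul] at hr
    rw [← mul_assoc, ← pow_succ', ← hr]
    rfl

theorem AffinePoint.mem_localRing_of_isIntegral (P : AffinePoint K q) {z : FunctionField K q}
    (hz : IsIntegral (CoordinateRing K q) z) : z ∈ P.localRing := by
  let : Algebra (CoordinateRing K q) P.localRing :=
    ((algebraMap _ (FunctionField K q)).codRestrict P.localRing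
      P.algebraMap_mem_localRing).toAlgebra
  have : IsScalarTower (CoordinateRing K q) P.localRing (FunctionField K q) :=
    IsScalarTower.of_algebraMap_eq fun _ => rfl
  obtain ⟨w, rfl⟩ := IsIntegrallyClosed.isIntegral_iff.1 (hz.tower_top (A := P.localRing))
  exact w.2

/-- Only integral closedness needs work. The discriminant bounds the denominator of an integral `z`
by a power of `x`; the local rings on `X = 0` are integrally closed and so contain `z`, and the
descent removes the denominator. -/
instance : IsDedekindDomain (CoordinateRing K q) := by
  refine (isDedekindDomain_iff (CoordinateRing K q) (FunctionField K q)).2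
    ⟨inferInstance, inferInstance, inferInstance, fun {z} hz => ?_⟩
  exact exists_eq_algebraMap_of_pow_mul
    (fun b => (chordPoint b).mem_localRing_of_isIntegral hz) _
    (exists_mul_eq_algebraMap_of_isIntegral (isIntegral_trans (R := K[X]) z hz))

/-- The place of the function field at a nonzero prime of the coordinate ring. -/
def primePlace (v : IsDedekindDomain.HeightOneSpectrum (CoordinateRing K q)) :
    Place K (FunctionField K q) where
  ring := v.valuationSubringAtPrime (FunctionField K q)
  algebraMap_mem c := by
    rw [IsScalarTower.algebraMap_apply K (CoordinateRing K q)]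
    exact (algebraMap (CoordinateRing K q)
      (v.valuationSubringAtPrime (FunctionField K q)) (algebraMap K _ c)).2
  isDVR := IsLocalization.AtPrime.isDiscreteValuationRing_of_dedekind_domain
    (CoordinateRing K q) v.ne_bot _

/-- A function that is regular at every place at which `x` and `y` are regular is a regular
function on the affine curve. -/
theorem exists_eq_algebraMap_of_forall_place {f : FunctionField K q}
    (hf : ∀ P : Place K (FunctionField K q), x K q ∈ P.ring → y K q ∈ P.ring → f ∈ P.ring) :
    ∃ r, algebraMap (CoordinateRing K q) (FunctionField K q) r = f := by
  refine IsDedekindDomain.HeightOneSpectrum.mem_integers_of_valuation_le_one _ f fun v => ?_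
  have hR (r : CoordinateRing K q) : algebraMap _ (FunctionField K q) r ∈ (primePlace v).ring :=
    (algebraMap (CoordinateRing K q) (v.valuationSubringAtPrime (FunctionField K q)) r).2
  exact v.valuationSubringAtPrime_le_valuation (hf (primePlace v) (hR _) (hR _))

end

end Hermitian

/-! ### The point at infinity, and orders of monomials there and at `O`. -/

/-- If the nonzero terms of a finite sum have pairwise distinct valuations, none of them exceeds
the valuation of the sum. -/
theorem Valuation.le_map_sum_of_pairwise_ne {R Γ ι : Type*} [Ring R]
    [LinearOrderedCommGroupWithZero Γ] (v : Valuation R Γ) {s : Finset ι} {f : ι → R}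
    (h : ∀ i ∈ s, ∀ j ∈ s, i ≠ j → v (f i) ≠ 0 → v (f i) ≠ v (f j)) {i : ι} (hi : i ∈ s) :
    v (f i) ≤ v (∑ j ∈ s, f j) := by
  classical
  obtain ⟨j, hj, hmax⟩ := s.exists_max_image (fun i => v (f i)) ⟨i, hi⟩
  by_cases h0 : v (f j) = 0
  · exact (hmax i hi).trans (h0 ▸ zero_le)
  rw [v.map_sum_eq_of_lt hj]
  · exact hmax i hi
  · intro k hk
    rw [Finset.mem_sdiff, Finset.mem_singleton] at hk
    exact lt_of_le_of_ne (hmax k hk.1) (h j hj k hk.1 (Ne.symm hk.2) h0).symm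

/-- If the monomials of `p` have distinct weights, none of them exceeds the valuation
of `p (s, t)`. -/
theorem Place.exp_le_valuation_aeval {K F : Type*} [Field K] [Field F] [Algebra K F]
    (P : Place K F) {s t : F} {a b : ℤ} (hs : P.valuation s = WithZero.exp a)
    (ht : P.valuation t = WithZero.exp b) {p : MvPolynomial (Fin 2) K}
    (hp : Set.InjOn (fun d : Fin 2 →₀ ℕ => (d 0 : ℤ) * a + d 1 * b) p.support)
    {d : Fin 2 →₀ ℕ} (hd : d ∈ p.support) :
    WithZero.exp ((d 0 : ℤ) * a + d 1 * b) ≤ P.valuation (MvPolynomial.aeval ![s, t] p) := by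
  have hterm (e) (he : e ∈ p.support) : P.valuation (algebraMap K F (p.coeff e) *
      ∏ i, ![s, t] i ^ e i) = WithZero.exp ((e 0 : ℤ) * a + e 1 * b) := by
    rw [Fin.prod_univ_two, map_mul, map_mul, map_pow, map_pow,
      P.valuation_algebraMap (MvPolynomial.mem_support_iff.1 he), one_mul]
    simp [hs, ht, ← WithZero.exp_nsmul, ← WithZero.exp_add]
  rw [MvPolynomial.aeval_def, MvPolynomial.eval₂_eq', ← hterm d hd]
  refine P.valuation.le_map_sum_of_pairwise_ne (f := fun e => algebraMap K F (p.coeff e) *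
    ∏ i, ![s, t] i ^ e i) (fun i hi j hj hij _ h => hij (hp hi hj ?_)) hd
  rw [hterm i hi, hterm j hj] at h
  exact WithZero.exp_injective h

namespace Hermitian

section

variable (K : Type*) [Field K] (q : ℕ) [Finite K] [hK : Fact (Nat.card K = q ^ 2)]

theorem y_ne_zero : y K q ≠ 0 := by
  intro h
  have h1 := equation_x_y K q
  have := two_le K q
  rw [h, zero_pow (by omega), add_zero] at h1
  exact pow_ne_zero _ (x_ne_zero K q) h1.symm

/-- The coordinates at infinity `x / y` and `1 / y` satisfy the equation of the curve. -/
theorem equation_at_infinity : (y K q)⁻¹ ^ q + (y K q)⁻¹ = (x K q / y K q) ^ (q + 1) := by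
  have hy := y_ne_zero K q
  rw [div_pow, ← equation_x_y, pow_succ, inv_pow]
  field_simp
  ring

theorem transcendental_y : Transcendental K (y K q) := by
  rw [transcendental_iff_injective]
  have h : ⇑(aeval (R := K) (y K q)) = algebraMap K[X] (FunctionField K q) := by
    have h1 : aeval (R := K) (y K q) = IsScalarTower.toAlgHom K K[X] (FunctionField K q) := by
      ext
      simp only [aeval_X, IsScalarTower.coe_toAlgHom']
      rfl
    rw [h1]; rfl
  rw [h, IsScalarTower.algebraMap_eq K[X] (CoordinateRing K q), RingHom.coe_comp]
  exact (IsFractionRing.injective (CoordinateRing K q) _).comp (algebraMap_polynomial_injective K q)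

theorem transcendental_inv_y : Transcendental K (y K q)⁻¹ := fun h =>
  transcendental_y K q (by simpa using h.inv)

/-- The pullback of regular functions along the involution `(x, y) ↦ (x / y, 1 / y)`. -/
def involutionRegular : CoordinateRing K q →ₐ[K] FunctionField K q :=
  AdjoinRoot.liftAlgHom (equation K q) (aeval (y K q)⁻¹) (x K q / y K q) (by
    change eval₂ _ _ (X ^ (q + 1) - C (X ^ q + X)) = 0
    rw [eval₂_sub, eval₂_X_pow, eval₂_C, ← equation_at_infinity]
    simp)

/-- By integrality over `K[Y]`, a prime meeting `K[Y]` only in zero is zero; the kernel is such a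
prime because `1 / y` is transcendental. -/
theorem involutionRegular_injective : Function.Injective (involutionRegular K q) := by
  have hprime : (RingHom.ker (involutionRegular K q)).IsPrime := RingHom.ker_isPrime _
  refine (RingHom.injective_iff_ker_eq_bot _).2 (Ideal.eq_bot_of_comap_eq_bot (R := K[X]) ?_)
  rw [eq_bot_iff]
  intro p hp
  have h : aeval (y K q)⁻¹ p = 0 := by
    have h1 : involutionRegular K q (AdjoinRoot.of (equation K q) p) = 0 := hp
    rwa [involutionRegular, AdjoinRoot.liftAlgHom_of] at h1
  exact transcendental_iff.1 (transcendental_inv_y K q) p h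

/-- The involution `(x, y) ↦ (x / y, 1 / y)`, which exchanges `O` and the point at infinity. -/
def involution : FunctionField K q →ₐ[K] FunctionField K q :=
  IsFractionRing.liftAlgHom (involutionRegular_injective K q)

theorem involution_x : involution K q (x K q) = x K q / y K q := by
  rw [involution, IsFractionRing.coe_liftAlgHom, x, IsFractionRing.lift_algebraMap]
  exact AdjoinRoot.liftAlgHom_root _ _ _ _

theorem involution_y : involution K q (y K q) = (y K q)⁻¹ := by
  rw [involution, IsFractionRing.coe_liftAlgHom, y, IsFractionRing.lift_algebraMap]
  refine (AdjoinRoot.liftAlgHom_of _ _ _ _ _).trans ?_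
  rw [aeval_X, y]

theorem involution_aeval (p : MvPolynomial (Fin 2) K) :
    involution K q (MvPolynomial.aeval ![x K q, y K q] p) =
      MvPolynomial.aeval ![x K q / y K q, (y K q)⁻¹] p := by
  rw [MvPolynomial.comp_aeval_apply]
  congr 2
  ext i
  fin_cases i
  · exact involution_x K q
  · exact involution_y K q

theorem involution_involution (f : FunctionField K q) :
    involution K q (involution K q f) = f := by
  have hR (r : CoordinateRing K q) : involution K q (involution K q (algebraMap _ _ r)) =
      algebraMap _ (FunctionField K q) r := by
    obtain ⟨p, -, rfl⟩ := exists_aeval_eq K q r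
    rw [algebraMap_aeval, involution_aeval, MvPolynomial.comp_aeval_apply]
    congr 2
    ext i
    fin_cases i
    · change involution K q (x K q / y K q) = x K q
      rw [map_div₀, involution_x, involution_y, div_inv_eq_mul,
        div_mul_cancel₀ _ (y_ne_zero K q)]
    · change involution K q (y K q)⁻¹ = y K q
      rw [map_inv₀, involution_y, inv_inv]
  obtain ⟨r, s, -, rfl⟩ := IsFractionRing.div_surjective (A := CoordinateRing K q) f
  rw [map_div₀, map_div₀, hR, hR]

/-- The point `O = (0, 0)`. -/
def origin : AffinePoint K q := chordPoint ⟨0, zero_mem_kernelRoots⟩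

theorem valuation_origin_x : (origin K q).place.valuation (x K q) = WithZero.exp (-1 : ℤ) := by
  rw [← (origin K q).valuation_param, origin, chordPoint_param]

/-- In `y * (y ^ (q - 1) + 1) = x ^ (q + 1)` the second factor is a unit at `O`. -/
theorem valuation_origin_y :
    (origin K q).place.valuation (y K q) = WithZero.exp (-(q + 1) : ℤ) := by
  have hq := two_le K q
  set O := origin K q with hO
  have hev : O.eval (yR K q ^ (q - 1) + 1) ≠ 0 := by
    rw [map_add, map_pow, AffinePoint.eval_yR, map_one]
    change (0 : K) ^ (q - 1) + 1 ≠ 0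
    rw [zero_pow (by omega), zero_add]
    exact one_ne_zero
  have h0 := O.algebraMap_ne_zero_of_eval hev
  have h1 : O.place.valuation (algebraMap _ _ (yR K q ^ (q - 1) + 1)) = 1 := by
    refine le_antisymm (O.place.mem_ring_iff.1 (O.algebraMap_mem_localRing _)) ?_
    have := O.place.mem_ring_iff.1 (O.inv_algebraMap_mem_localRing hev)
    rw [map_inv₀] at this
    exact (inv_le_one₀ (zero_lt_iff.2 ((Valuation.ne_zero_iff _).2 h0))).1 this
  have h2 : y K q * algebraMap _ _ (yR K q ^ (q - 1) + 1) = x K q ^ (q + 1) := by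
    rw [← equation_x_y, map_add, map_pow, map_one, mul_add, mul_one, ← y, ← pow_succ',
      Nat.sub_add_cancel (by omega)]
  have h3 := congrArg O.place.valuation h2
  rw [map_mul, h1, mul_one, map_pow, valuation_origin_x, ← WithZero.exp_nsmul] at h3
  rw [h3]
  congr 1
  simp

/-- The place at the point at infinity. -/
def infinityPlace : Place K (FunctionField K q) where
  ring := (origin K q).localRing.comap (involution K q).toRingHom
  algebraMap_mem c := by
    rw [ValuationSubring.mem_comap]
    change involution K q (algebraMap K _ c) ∈ _
    rw [AlgHom.commutes]
    exact (origin K q).const_mem_localRing c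
  isDVR := by
    have := (origin K q).isDVR_localRing
    have hmem (f : (origin K q).localRing) : involution K q f.1 ∈
        (origin K q).localRing.comap (involution K q).toRingHom := by
      rw [ValuationSubring.mem_comap]
      change involution K q (involution K q f) ∈ _
      rw [involution_involution]
      exact f.2
    let φ : (origin K q).localRing →+*
        (origin K q).localRing.comap (involution K q).toRingHom :=
      ((involution K q).toRingHom.comp (origin K q).localRing.subtype).codRestrict _ hmem
    have hφ : Function.Bijective φ := by
      constructor
      · intro f g h
        exact Subtype.ext ((involution K q).injective (congrArg Subtype.val h))
      · rintro ⟨g, hg⟩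
        exact ⟨⟨involution K q g, hg⟩, Subtype.ext (involution_involution K q g)⟩
    exact IsDiscreteValuationRing.RingEquivClass.isDiscreteValuationRing
      (RingEquiv.ofBijective φ hφ)

variable {K q}

theorem mem_infinityPlace_ring {f : FunctionField K q} :
    f ∈ (infinityPlace K q).ring ↔ involution K q f ∈ (origin K q).localRing := Iff.rfl

theorem y_notMem_infinityPlace_ring : y K q ∉ (infinityPlace K q).ring := by
  rw [mem_infinityPlace_ring, involution_y]
  intro h
  have h1 := (origin K q).place.mem_ring_iff.1 h
  rw [map_inv₀, valuation_origin_y, ← WithZero.exp_neg, ← WithZero.exp_zero,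
    WithZero.exp_le_exp] at h1
  omega

theorem eq_of_dvd_sub_of_le {i j : ℕ} (hi : i ≤ q) (hj : j ≤ q)
    (h : (q + 1 : ℤ) ∣ (i : ℤ) - j) : i = j := by
  have := Int.eq_zero_of_abs_lt_dvd h (by rw [abs_lt]; omega)
  omega

/-- Modulo `q + 1` the weight is `-d 0`, which determines `d 0` because `d 0 ≤ q`; then `d 1`
follows. -/
theorem injOn_poleOrder {p : MvPolynomial (Fin 2) K} (hp : ∀ d ∈ p.support, d 0 ≤ q) :
    Set.InjOn (fun d : Fin 2 →₀ ℕ => (d 0 : ℤ) * q + d 1 * (q + 1)) p.support := by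
  intro d hd e he h
  replace h : (d 0 : ℤ) * q + d 1 * (q + 1) = (e 0 : ℤ) * q + e 1 * (q + 1) := h
  have h0 : d 0 = e 0 := eq_of_dvd_sub_of_le (hp d hd) (hp e he)
    ⟨d 0 + d 1 - e 0 - e 1, by linear_combination -h⟩
  rw [h0, add_right_inj] at h
  have h1 : d 1 = e 1 := by exact_mod_cast mul_right_cancel₀ (by omega) h
  ext i
  fin_cases i <;> assumption

theorem injOn_vanishingOrder {p : MvPolynomial (Fin 2) K} (hp : ∀ d ∈ p.support, d 0 ≤ q) :
    Set.InjOn (fun d : Fin 2 →₀ ℕ => (d 0 : ℤ) * (-1) + d 1 * (-(q + 1))) p.support := by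
  intro d hd e he h
  replace h : (d 0 : ℤ) * (-1) + d 1 * (-(q + 1)) = (e 0 : ℤ) * (-1) + e 1 * (-(q + 1)) := h
  have h0 : d 0 = e 0 := eq_of_dvd_sub_of_le (hp d hd) (hp e he)
    ⟨e 1 - d 1, by linear_combination -h⟩
  rw [h0, add_right_inj] at h
  have h1 : d 1 = e 1 := by exact_mod_cast mul_right_cancel₀ (by omega) h
  ext i
  fin_cases i <;> assumption

theorem valuation_origin_x_div_y :
    (origin K q).place.valuation (x K q / y K q) = WithZero.exp (q : ℤ) := by
  rw [map_div₀, valuation_origin_x, valuation_origin_y, ← WithZero.exp_sub]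
  congr 1
  ring

theorem valuation_origin_inv_y :
    (origin K q).place.valuation (y K q)⁻¹ = WithZero.exp (q + 1 : ℤ) := by
  rw [map_inv₀, valuation_origin_y, ← WithZero.exp_neg, neg_neg]

/-- The pole order at infinity of `p (x, y)` bounds the pole orders of its monomials. -/
theorem exp_poleOrder_le {p : MvPolynomial (Fin 2) K} (hp : ∀ d ∈ p.support, d 0 ≤ q)
    {d : Fin 2 →₀ ℕ} (hd : d ∈ p.support) :
    WithZero.exp ((d 0 : ℤ) * q + d 1 * (q + 1)) ≤ (origin K q).place.valuation
      (involution K q (MvPolynomial.aeval ![x K q, y K q] p)) := by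
  rw [involution_aeval]
  exact Place.exp_le_valuation_aeval _ valuation_origin_x_div_y valuation_origin_inv_y
    (injOn_poleOrder hp) hd

/-- The order of vanishing at `O` of `p (x, y)` is at most that of each of its monomials. -/
theorem exp_vanishingOrder_le {p : MvPolynomial (Fin 2) K} (hp : ∀ d ∈ p.support, d 0 ≤ q)
    {d : Fin 2 →₀ ℕ} (hd : d ∈ p.support) :
    WithZero.exp ((d 0 : ℤ) * (-1) + d 1 * (-(q + 1))) ≤ (origin K q).place.valuation
      (MvPolynomial.aeval ![x K q, y K q] p) :=
  Place.exp_le_valuation_aeval _ (valuation_origin_x K q) (valuation_origin_y K q)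
    (injOn_vanishingOrder hp) hd

/-- The monomials in `x` and `y` of degree at most `q` in `x` are linearly independent. -/
theorem eq_zero_of_aeval_eq_zero {p : MvPolynomial (Fin 2) K} (hp : ∀ d ∈ p.support, d 0 ≤ q)
    (h : MvPolynomial.aeval ![x K q, y K q] p = 0) : p = 0 := by
  by_contra h0
  obtain ⟨d, hd⟩ := MvPolynomial.support_nonempty.2 h0
  have := exp_vanishingOrder_le hp hd
  rw [h, Valuation.map_zero] at this
  exact WithZero.exp_ne_zero (le_zero_iff.1 this)

end

end Hermitian

/-! ### The two inclusions for the Riemann–Roch space. -/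

/-- If `t ^ q + t = s ^ (q + 1)` and `t` vanishes at `v`, then `t` vanishes there to order at least
`m` times that of `s`, for every `m ≤ q + 1`. -/
theorem Valuation.le_pow_of_hermitian {F Γ : Type*} [Field F] [LinearOrderedCommGroupWithZero Γ]
    (v : Valuation F Γ) {q m : ℕ} (hq : 2 ≤ q) (hm : m ≤ q + 1) {s t : F}
    (h : t ^ q + t = s ^ (q + 1)) (ht : v t < 1) : v t ≤ v s ^ m := by
  have h1 : v (t ^ (q - 1)) < v 1 := by
    rw [map_pow, map_one]
    exact pow_lt_one₀ zero_le ht (by omega)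
  have h2 : v (t ^ (q - 1) + 1) = 1 := by
    rw [v.map_add_eq_of_lt_right h1, map_one]
  have h3 : v t = v s ^ (q + 1) := by
    rw [← map_pow, ← h, ← mul_one (v t), ← h2, ← map_mul, mul_add, mul_one, ← pow_succ',
      Nat.sub_add_cancel (by omega)]
  have h4 : v s ≤ 1 := by
    by_contra hs
    rw [h3] at ht
    exact absurd ht (not_lt.2 (one_le_pow₀ (not_le.1 hs).le))
  rw [h3]
  exact pow_le_pow_right_of_le_one' h4 hm

theorem Place.valuation_aeval_le {K F : Type*} [Field K] [Field F] [Algebra K F]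
    (P : Place K F) {s t : F} (hs : P.valuation s ≤ P.valuation t) (ht : 1 ≤ P.valuation t)
    {n : ℕ} {g : MvPolynomial (Fin 2) K} (hg : g.totalDegree ≤ n) :
    P.valuation (MvPolynomial.aeval ![s, t] g) ≤ P.valuation t ^ n := by
  rw [MvPolynomial.aeval_def, MvPolynomial.eval₂_eq']
  refine P.valuation.map_sum_le fun d hd => ?_
  rw [Fin.prod_univ_two, map_mul, map_mul, map_pow, map_pow,
    P.valuation_algebraMap (MvPolynomial.mem_support_iff.1 hd), one_mul]
  have h1 := (MvPolynomial.le_totalDegree hd).trans hg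
  rw [Finsupp.sum_fintype _ _ (by simp), Fin.sum_univ_two] at h1
  change P.valuation s ^ d 0 * P.valuation t ^ d 1 ≤ _
  calc P.valuation s ^ d 0 * P.valuation t ^ d 1
      ≤ P.valuation t ^ d 0 * P.valuation t ^ d 1 := by gcongr
    _ = P.valuation t ^ (d 0 + d 1) := (pow_add _ _ _).symm
    _ ≤ P.valuation t ^ n := pow_le_pow_right₀ ht h1

namespace Hermitian

variable {K : Type*} [Field K] {q : ℕ} [Finite K] [hK : Fact (Nat.card K = q ^ 2)]

theorem valuation_x_pos (P : Place K (FunctionField K q)) : 0 < P.valuation (x K q) :=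
  zero_lt_iff.2 ((Valuation.ne_zero_iff _).2 (x_ne_zero K q))

theorem valuation_y_pos (P : Place K (FunctionField K q)) : 0 < P.valuation (y K q) :=
  zero_lt_iff.2 ((Valuation.ne_zero_iff _).2 (y_ne_zero K q))

theorem x_mem_of_y_mem {P : Place K (FunctionField K q)} (hy : y K q ∈ P.ring) :
    x K q ∈ P.ring := by
  have h : x K q ^ (q + 1) ∈ P.ring := by
    rw [← equation_x_y]
    exact add_mem (pow_mem hy q) hy
  rw [P.mem_ring_iff, map_pow] at h
  rw [P.mem_ring_iff]
  by_contra hx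
  exact absurd h (not_le.2 (one_lt_pow₀ (not_le.1 hx) (Nat.succ_ne_zero q)))

/-- At a place at which `y` has a pole, `y g (x, y)` is divisible by `x ^ m`. -/
theorem valuation_le_of_y_notMem {P : Place K (FunctionField K q)} (hy : y K q ∉ P.ring)
    {m : ℕ} (hm : 2 ≤ m) (hmq : m ≤ q + 1) {g : MvPolynomial (Fin 2) K}
    (hg : g.totalDegree ≤ m - 2) :
    P.valuation (y K q * MvPolynomial.aeval ![x K q, y K q] g) ≤ P.valuation (x K q) ^ m := by
  rw [P.mem_ring_iff, not_le] at hy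
  have hy0 := valuation_y_pos P
  have hinv : P.valuation (y K q)⁻¹ < 1 := by
    rw [map_inv₀]
    exact inv_lt_one_of_one_lt₀ hy
  -- The pair `(x / y, 1 / y)` satisfies the curve equation and `1 / y` vanishes at `P`. Working
  -- with this pair covers every pole of `y`, without knowing that there is only one.
  have key (n : ℕ) (hn : n ≤ q + 1) :
      (P.valuation (y K q))⁻¹ ≤ (P.valuation (x K q) / P.valuation (y K q)) ^ n := by
    rw [← map_div₀, ← map_inv₀]
    exact P.valuation.le_pow_of_hermitian (two_le K q) hn (equation_at_infinity K q) hinv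
  have hxy : P.valuation (x K q) ≤ P.valuation (y K q) := by
    by_contra hxy
    have h1 := congrArg P.valuation (equation_at_infinity K q)
    have h2 : P.valuation ((y K q)⁻¹ ^ q + (y K q)⁻¹) < 1 := by
      refine Valuation.map_add_lt _ ?_ hinv
      rw [map_pow]
      have := two_le K q
      exact pow_lt_one₀ zero_le hinv (by omega)
    rw [h1, map_pow, map_div₀] at h2
    exact absurd h2 (not_lt.2 (one_le_pow₀ ((one_le_div₀ hy0).2 (not_le.1 hxy).le)))
  rw [map_mul]
  calc P.valuation (y K q) * P.valuation (MvPolynomial.aeval ![x K q, y K q] g)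
      ≤ P.valuation (y K q) * P.valuation (y K q) ^ (m - 2) := by
        gcongr
        exact P.valuation_aeval_le hxy hy.le hg
    _ = (P.valuation (y K q))⁻¹ * P.valuation (y K q) ^ m := by
        rw [← pow_succ', eq_inv_mul_iff_mul_eq₀ hy0.ne', ← pow_succ']
        congr 1
        omega
    _ ≤ (P.valuation (x K q) / P.valuation (y K q)) ^ m * P.valuation (y K q) ^ m := by
        gcongr
        exact key m hmq
    _ = P.valuation (x K q) ^ m := by rw [← mul_pow, div_mul_cancel₀ _ hy0.ne']

/-- A place at which `x` vanishes and `y` is regular lies over a point `(0, b)`. -/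
theorem exists_eq_chordPoint_place {P : Place K (FunctionField K q)} (hy : y K q ∈ P.ring)
    (hx : P.valuation (x K q) < 1) : ∃ b : kernelRoots K q,
      P = (chordPoint b).place ∧ P.valuation (y K q - algebraMap K _ b) < 1 := by
  -- Where `x` vanishes, some factor `y - b` of `y ^ q + y` must vanish too.
  have hprod : ∏ b ∈ kernelRoots K q, (y K q - algebraMap K (FunctionField K q) b) =
      x K q ^ (q + 1) := by
    have h := congrArg (aeval (y K q)) (prod_X_sub_C_kernelRoots K q)
    rw [map_prod] at h
    simpa [equation_x_y] using h
  have hex : ∃ b ∈ kernelRoots K q, P.valuation (y K q - algebraMap K _ b) < 1 := by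
    by_contra! hcon
    have h1 := congrArg P.valuation hprod
    rw [map_prod, Finset.prod_eq_one fun b hb => le_antisymm
      (P.mem_ring_iff.1 (sub_mem hy (P.algebraMap_mem b))) (hcon b hb), map_pow] at h1
    exact absurd h1.symm (pow_lt_one₀ zero_le hx (Nat.succ_ne_zero q)).ne
  obtain ⟨b, hb, h⟩ := hex
  refine ⟨⟨b, hb⟩, (chordPoint ⟨b, hb⟩).eq_place ?_ h, h⟩
  rw [← AffinePoint.param, chordPoint_param]
  exact hx

/-- At the `Q_i` the factor `x ^ m` clears the denominator. Any other place is a pole of `y`, or has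
`x` as a unit, or lies over `O`, where `y` is divisible by `x ^ (q + 1)` in the local ring. -/
theorem mem_riemannRochSpace_of_aeval {m : ℕ} (hm : 2 ≤ m) (hmq : m ≤ q + 1)
    {g : MvPolynomial (Fin 2) K} (hg : g.totalDegree ≤ m - 2) (ε : K) :
    (y K q * MvPolynomial.aeval ![x K q, y K q] g +
      algebraMap K (FunctionField K q) ε * x K q ^ m) / x K q ^ m ∈
      riemannRochSpace (chordDivisor K q m) := by
  have hx0 := pow_ne_zero m (x_ne_zero K q)
  rw [mem_riemannRochSpace_chordDivisor]
  refine ⟨fun Q _ => ?_, fun P hP => ?_⟩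
  · rw [div_mul_cancel₀ _ hx0]
    have hx := Q.x_mem_localRing
    have hy := Q.y_mem_localRing
    exact add_mem (mul_mem hy (Q.place.aeval_mem hx hy g))
      (mul_mem (Q.const_mem_localRing ε) (pow_mem hx m))
  · rw [add_div, mul_div_cancel_right₀ _ hx0]
    refine add_mem ?_ (P.algebraMap_mem ε)
    rw [P.mem_ring_iff, map_div₀, map_pow, div_le_one₀ (pow_pos (valuation_x_pos P) m)]
    by_cases hy : y K q ∈ P.ring
    · have hx := x_mem_of_y_mem hy
      have hg1 := P.mem_ring_iff.1 (P.aeval_mem hx hy g)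
      rcases (P.mem_ring_iff.1 hx).lt_or_eq with hlt | heq
      · obtain ⟨b, hPb, hb⟩ := exists_eq_chordPoint_place hy hlt
        have hb0 : (b : K) = 0 := by
          by_contra hb0
          exact hP _ ((mem_chordPoints K q).2 ⟨rfl, hb0⟩) hPb
        rw [hb0, map_zero, sub_zero] at hb
        rw [map_mul]
        exact (mul_le_of_le_one_right' hg1).trans
          (P.valuation.le_pow_of_hermitian (two_le K q) hmq (equation_x_y K q) hb)
      · rw [heq, one_pow, ← P.mem_ring_iff]
        exact mul_mem hy (P.aeval_mem hx hy g)
    · exact valuation_le_of_y_notMem hy hm hmq hg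

/-- A function in the Riemann–Roch space of the chord divisor is `p (x, y) / x ^ m`, where the
monomials of `p` other than `X ^ m` are divisible by `Y` and have degree less than `m`. -/
theorem exists_aeval_of_mem_riemannRochSpace {m : ℕ} {f : FunctionField K q}
    (hf : f ∈ riemannRochSpace (chordDivisor K q m)) : ∃ p : MvPolynomial (Fin 2) K,
      f * x K q ^ m = MvPolynomial.aeval ![x K q, y K q] p ∧
      ∀ d ∈ p.support, d 1 = 0 ∧ d 0 = m ∨ 1 ≤ d 1 ∧ d 0 + d 1 + 1 ≤ m := by
  rw [mem_riemannRochSpace_chordDivisor] at hf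
  obtain ⟨hQ, hP⟩ := hf
  obtain ⟨r, hr⟩ := exists_eq_algebraMap_of_forall_place (f := f * x K q ^ m) fun P hx _ => by
    by_cases h : ∀ Q ∈ chordPoints K q, P ≠ Q.place
    · exact mul_mem (hP P h) (pow_mem hx m)
    · push Not at h
      obtain ⟨Q, hm, rfl⟩ := h
      exact hQ Q hm
  obtain ⟨p, hp, rfl⟩ := exists_aeval_eq K q r
  rw [algebraMap_aeval] at hr
  refine ⟨p, hr.symm, fun d hd => ?_⟩
  set O := (origin K q).place with hO
  have hfO : f ∈ O.ring := hP _ fun Q hQm h => by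
    have h1 := AffinePoint.place_injective h
    rw [← h1, mem_chordPoints] at hQm
    exact hQm.2 rfl
  have hfinf : f ∈ (infinityPlace K q).ring := hP _ fun Q _ h =>
    y_notMem_infinityPlace_ring (by rw [h]; exact Q.y_mem_localRing)
  rw [mem_infinityPlace_ring] at hfinf
  have hzero := exp_vanishingOrder_le hp hd
  rw [hr, map_mul, map_pow, valuation_origin_x, ← WithZero.exp_nsmul] at hzero
  replace hzero := WithZero.exp_le_exp.1
    (hzero.trans (mul_le_of_le_one_left' (O.mem_ring_iff.1 hfO)))
  have hpole := exp_poleOrder_le hp hd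
  rw [hr, map_mul, map_mul, map_pow, map_pow, involution_x, valuation_origin_x_div_y,
    ← WithZero.exp_nsmul] at hpole
  replace hpole := WithZero.exp_le_exp.1
    (hpole.trans (mul_le_of_le_one_left' (O.mem_ring_iff.1 hfinf)))
  rw [nsmul_eq_mul] at hzero hpole
  have hq := two_le K q
  -- The pole bound reads `d 0 * q + d 1 * (q + 1) ≤ m * q`; drop the extra `d 1`.
  have hle : d 0 + d 1 ≤ m := by
    have h1 : ((d 0 + d 1 : ℕ) : ℤ) * q ≤ (m : ℤ) * q := by push_cast; nlinarith
    exact_mod_cast le_of_mul_le_mul_right h1 (by omega)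
  rcases Nat.eq_zero_or_pos (d 1) with h0 | h0
  · left
    rw [h0] at hzero
    refine ⟨h0, ?_⟩
    push_cast at hzero
    omega
  · right
    refine ⟨h0, ?_⟩
    -- If `d 0 + d 1 = m`, the pole bound is exceeded by exactly `d 1`, which is positive.
    by_contra hcon
    have heq : (d 0 : ℤ) + d 1 = m := by omega
    rw [← heq] at hpole
    nlinarith

theorem coe_riemannRochSpace_chordDivisor {m : ℕ} (hm : 2 ≤ m) (hmq : m ≤ q + 1) :
    (riemannRochSpace (chordDivisor K q m) : Set (FunctionField K q)) =
      {f | ∃ (g : MvPolynomial (Fin 2) K) (ε : K), g.totalDegree ≤ m - 2 ∧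
        f = (y K q * MvPolynomial.aeval ![x K q, y K q] g +
          algebraMap K (FunctionField K q) ε * x K q ^ m) / x K q ^ m} := by
  ext f
  constructor
  · intro hf
    obtain ⟨p, hpf, hp⟩ := exists_aeval_of_mem_riemannRochSpace hf
    -- Division of `p` by `Y`: the quotient is `g`, and the remainder can only be the `X ^ m` term.
    refine ⟨p.divMonomial (Finsupp.single 1 1), p.coeff (Finsupp.single 0 m), ?_, ?_⟩
    · refine Finset.sup_le fun d hd => ?_
      rw [MvPolynomial.mem_support_iff, MvPolynomial.coeff_divMonomial,
        ← MvPolynomial.mem_support_iff] at hd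
      rw [Finsupp.sum_fintype _ _ (by simp), Fin.sum_univ_two]
      have := hp _ hd
      simp at this
      omega
    · have hmod : p.modMonomial (Finsupp.single 1 1) =
          MvPolynomial.C (p.coeff (Finsupp.single 0 m)) * MvPolynomial.X 0 ^ m := by
        rw [MvPolynomial.C_mul_X_pow_eq_monomial]
        ext d
        rw [MvPolynomial.coeff_monomial]
        by_cases hd : Finsupp.single 1 1 ≤ d
        · rw [MvPolynomial.coeff_modMonomial_of_le _ hd, if_neg]
          rintro rfl
          simpa using hd 1
        · rw [MvPolynomial.coeff_modMonomial_of_not_le _ hd]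
          split_ifs with h
          · rw [h]
          · by_contra h0
            have h1 : d 1 = 0 := by
              by_contra h1
              exact hd (Finsupp.single_le_iff.2 (by omega))
            rcases hp d (MvPolynomial.mem_support_iff.2 h0) with h2 | h2
            · refine h (Finsupp.ext fun i => ?_)
              fin_cases i
              · simp [h2.2]
              · simp [h1]
            · omega
      rw [eq_div_iff (pow_ne_zero m (x_ne_zero K q)), hpf]
      conv_lhs => rw [← MvPolynomial.divMonomial_add_modMonomial_single p 1, hmod]
      simp
  · rintro ⟨g, ε, hg, rfl⟩
    exact mem_riemannRochSpace_of_aeval hm hmq hg ε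

end Hermitian

/-! ### The dimension. -/

theorem MvPolynomial.finrank_restrictTotalDegree_fin_two (K : Type*) [Field K] (n : ℕ) :
    Module.finrank K (MvPolynomial.restrictTotalDegree (Fin 2) K n) =
      ∑ k ∈ Finset.range (n + 1), (k + 1) := by
  rw [MvPolynomial.restrictTotalDegree,
    Module.finrank_eq_nat_card_basis (MvPolynomial.basisRestrictSupport K _)]
  -- Pairs of a total degree `k ≤ n` and an exponent of the first variable, at most `k`.
  let T := (Finset.range (n + 1)).sigma fun k => Finset.range (k + 1)
  have hT : T.card = ∑ k ∈ Finset.range (n + 1), (k + 1) := by simp [T]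
  let φ : (_ : ℕ) × ℕ → Fin 2 →₀ ℕ := fun z => Finsupp.single 0 z.2 + Finsupp.single 1 (z.1 - z.2)
  have hφ0 (z) : φ z 0 = z.2 := by simp [φ]
  have hφ1 (z) : φ z 1 = z.1 - z.2 := by simp [φ]
  have himage : {d : Fin 2 →₀ ℕ | (d.sum fun _ e => e) ≤ n} = φ '' T := by
    ext d
    rw [Set.mem_ofPred_eq, Finsupp.sum_fintype _ _ (by simp), Fin.sum_univ_two]
    constructor
    · intro h
      refine ⟨⟨d 0 + d 1, d 0⟩, ?_, Finsupp.ext fun i => ?_⟩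
      · simp only [T, SetLike.mem_coe, Finset.mem_sigma, Finset.mem_range]
        omega
      · fin_cases i
        · exact hφ0 _
        · exact (hφ1 _).trans (Nat.add_sub_cancel_left _ _)
    · rintro ⟨z, hz, rfl⟩
      simp only [T, SetLike.mem_coe, Finset.mem_sigma, Finset.mem_range] at hz
      rw [hφ0, hφ1]
      omega
  have hinj : Set.InjOn φ T := by
    rintro ⟨k, i⟩ hz ⟨l, j⟩ hw h
    simp only [T, SetLike.mem_coe, Finset.mem_sigma, Finset.mem_range] at hz hw
    have h0 : i = j := by simpa [hφ0] using DFunLike.congr_fun h 0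
    have h1 : k - i = l - j := by simpa [hφ1] using DFunLike.congr_fun h 1
    have h2 : k = l := by omega
    rw [h0, h2]
  rw [← hT, Nat.card_coe_set_eq, himage, hinj.ncard_image, Set.ncard_coe_finset]

theorem sum_range_add_one_cast (n : ℕ) :
    ((∑ k ∈ Finset.range (n + 1), (k + 1) : ℕ) : ℚ) = (n + 1) * (n + 2) / 2 := by
  induction n with
  | zero => norm_num
  | succ n ih =>
    rw [Finset.sum_range_succ, Nat.cast_add, ih]
    push_cast
    ring

namespace Hermitian

variable {K : Type*} [Field K] {q : ℕ} [Finite K] [hK : Fact (Nat.card K = q ^ 2)]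

variable (K q) in
/-- The parametrization `(g, ε) ↦ (y g (x, y) + ε x ^ m) / x ^ m`. -/
def parametrization (m : ℕ) :
    MvPolynomial.restrictTotalDegree (Fin 2) K (m - 2) × K →ₗ[K] FunctionField K q :=
  (LinearMap.mulLeft K (y K q / x K q ^ m) ∘ₗ
    (MvPolynomial.aeval ![x K q, y K q]).toLinearMap ∘ₗ Submodule.subtype _).coprod
    (Algebra.linearMap K (FunctionField K q))

theorem parametrization_apply (m : ℕ)
    (g : MvPolynomial.restrictTotalDegree (Fin 2) K (m - 2)) (ε : K) :
    parametrization K q m (g, ε) = (y K q * MvPolynomial.aeval ![x K q, y K q] g.1 +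
      algebraMap K (FunctionField K q) ε * x K q ^ m) / x K q ^ m := by
  have hx0 := pow_ne_zero m (x_ne_zero K q)
  rw [add_div, mul_div_cancel_right₀ _ hx0, mul_div_right_comm]
  rfl

theorem range_parametrization {m : ℕ} (hm : 2 ≤ m) (hmq : m ≤ q + 1) :
    LinearMap.range (parametrization K q m) = riemannRochSpace (chordDivisor K q m) := by
  refine SetLike.coe_injective ?_
  rw [coe_riemannRochSpace_chordDivisor hm hmq]
  ext f
  constructor
  · rintro ⟨⟨g, ε⟩, rfl⟩
    exact ⟨g.1, ε, (MvPolynomial.mem_restrictTotalDegree _ _ _).1 g.2,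
      parametrization_apply m g ε⟩
  · rintro ⟨g, ε, hg, rfl⟩
    exact ⟨(⟨g, (MvPolynomial.mem_restrictTotalDegree _ _ _).2 hg⟩, ε),
      parametrization_apply m _ ε⟩

/-- The polynomial `Y g + ε X ^ m` has degree at most `m ≤ q`, so it is zero once it vanishes on the
curve; its two summands share no monomial. -/
theorem parametrization_injective {m : ℕ} (hm : 2 ≤ m) (hmq : m ≤ q) :
    Function.Injective (parametrization K q m) := by
  refine (injective_iff_map_eq_zero _).2 ?_
  rintro ⟨⟨g, hg⟩, ε⟩ h
  rw [MvPolynomial.mem_restrictTotalDegree] at hg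
  rw [parametrization_apply, div_eq_zero_iff,
    or_iff_left (pow_ne_zero m (x_ne_zero K q))] at h
  let p : MvPolynomial (Fin 2) K :=
    MvPolynomial.X 1 * g + MvPolynomial.C ε * MvPolynomial.X 0 ^ m
  have hdeg : p.totalDegree ≤ m := by
    refine (MvPolynomial.totalDegree_add _ _).trans (max_le ?_ ?_)
    · refine (MvPolynomial.totalDegree_mul _ _).trans ?_
      rw [MvPolynomial.totalDegree_X]
      omega
    · refine (MvPolynomial.totalDegree_mul _ _).trans ?_
      rw [MvPolynomial.totalDegree_C, MvPolynomial.totalDegree_X_pow, zero_add]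
  have hp : p = 0 := by
    refine eq_zero_of_aeval_eq_zero (q := q) (fun d hd => ?_) ?_
    · have h1 := (MvPolynomial.le_totalDegree hd).trans hdeg
      rw [Finsupp.sum_fintype _ _ (by simp), Fin.sum_univ_two] at h1
      omega
    · simpa [p] using h
  have hε : ε = 0 := by
    have h1 : p.coeff (Finsupp.single 0 m) = 0 := by rw [hp, MvPolynomial.coeff_zero]
    simpa [p, MvPolynomial.coeff_X_mul', MvPolynomial.C_mul_X_pow_eq_monomial] using h1
  have hg0 : g = 0 := by
    simpa [p, hε] using hp
  subst hε hg0
  rfl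

theorem finrank_riemannRochSpace_chordDivisor {m : ℕ} (hm : 2 ≤ m) (hmq : m ≤ q) :
    (Module.finrank K (riemannRochSpace (chordDivisor K q m)) : ℚ) =
      1 / 2 * m * (m - 1) + 1 := by
  rw [← range_parametrization hm (by omega),
    LinearMap.finrank_range_of_inj (parametrization_injective hm hmq), Module.finrank_prod,
    MvPolynomial.finrank_restrictTotalDegree_fin_two, Module.finrank_self]
  obtain ⟨n, rfl⟩ := Nat.exists_eq_add_of_le' hm
  rw [Nat.add_sub_cancel, Nat.cast_add, sum_range_add_one_cast]
  push_cast
  ring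

end Hermitian

end

theorem proposition2 (K : Type*) [Field K] [Finite K] (q : ℕ) [Fact (Nat.card K = q ^ 2)]
    (m : ℕ) (hm : 2 ≤ m) (hmq : m ≤ q - 1) :
    (Hermitian.chordPoints K q).card = q - 1 ∧
    (riemannRochSpace (Hermitian.chordDivisor K q m) : Set (Hermitian.FunctionField K q)) =
      {f | ∃ (g : MvPolynomial (Fin 2) K) (ε : K), g.totalDegree ≤ m - 2 ∧
        f = (Hermitian.y K q * MvPolynomial.aeval ![Hermitian.x K q, Hermitian.y K q] g +
          algebraMap K (Hermitian.FunctionField K q) ε * Hermitian.x K q ^ m) / Hermitian.x K q ^ m} ∧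
    (Hermitian.chordDivisor K q m).degree = m * ((q : ℤ) - 1) ∧
    (Module.finrank K (riemannRochSpace (Hermitian.chordDivisor K q m)) : ℚ) =
      1 / 2 * m * (m - 1) + 1 :=
  ⟨Hermitian.card_chordPoints K q, Hermitian.coe_riemannRochSpace_chordDivisor hm (by omega),
    Hermitian.degree_chordDivisor K q m,
    Hermitian.finrank_riemannRochSpace_chordDivisor hm (by omega)⟩
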